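/- **Definitions.** All vocabularies are first order, and "countable" means at most countable. For a model $M$, a set $B\subseteq M$ and a cardinal $\kappa$, let $a\in \mathrm{cl}_{<\kappa}(B,M)$ mean that for some quantifier-free formula $\varphi(y,x_1,\dots,x_n)$ and $b_1,\dots,b_n\in B$ we have $M\models\varphi[a,b_1,\dots,b_n]$ and $\varphi(y,b_1,\dots,b_n)$ has fewer than $\kappa$ solutions $y$ in $M$. For finite nonempty $w\subseteq M$ define "$\mathrm{rk}(w,M;<\kappa)\ge\alpha$" by induction on the ordinal $\alpha$: * $\mathrm{rk}(w,M;<\kappa)\ge 0$ iff no $a\in w$ is in $\mathrm{cl}_{<\kappa}(w\setminus\{a\},M)$; * for a limit $\delta$, $\mathrm{rk}(w,M;<\kappa)\ge\delta$ iff $\mathrm{rk}(w,M;<\kappa)\ge\alpha$ for all $\alpha<\delta$; * $\mathrm{rk}(w,M;<\kappa)\ge\beta+1$ iff, writing $w=\{a_0,\dots,a_{n-1}\}$ with $n=|w|$, for every $k<n$ and every quantifier-free $\varphi(x_0,\dots,x_{n-1})$ with $M\models\varphi[a_0,\dots,a_{n-1}]$ there are $a^i_m\in M$ ($i<2$, $m<n$)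 such that $\mathrm{rk}(\{a^i_m : i<2,\ m<n\},M;<\kappa)\ge\beta$, $M\models\varphi[a^i_0,\dots,a^i_{n-1}]$ for $i<2$, $a^0_k\ne a^1_k$, $a^0_m=a^1_m$ for $m\ne k$, and $a^0_m=a_m$ for all $m<n$. Let $\mathrm{rk}(w,M;<\kappa)$ be the maximal such $\alpha$ ($-1$ if there is none, $\infty$ if every $\alpha$ is such), and $\mathrm{rk}(M;<\kappa)=\sup\{\mathrm{rk}(w,M;<\kappa)+1 : w\subseteq M \text{ finite nonempty}\}$. $\Pr_{\omega_1}(\lambda)$ means that $\mathrm{rk}(M;<\aleph_1)\ge\omega_1$ for every model $M$ of cardinality $\lambda$ with countable vocabulary. **Claim.** (A) For every cardinal $\lambda$ the following are equivalent. 1. $\Pr_{\omega_1}(\lambda)$. 2. Whenever a sentence $\psi\in L_{\omega_1,\omega}(\tau)$, with $\tau$ a countable vocabulary and $R\in\tau$ a unary predicate, has a model $M$ with $|R^M|\ge\lambda$, then $\psi$ has a model of cardinality continuum; moreover there are a countable first order theory $T_1$ with Skolem functions, in a vocabulary containing $\tau$, a model $M_1$ of $T_1$ of cardinality continuum, and elements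 $a_\eta\in R^{M_1}$ for $\eta\in{}^\omega 2$ such that * $M_1\models\psi$; * (a) $M_1$ is the Skolem hull of $\{a_\eta:\eta\in{}^\omega2\}$, and $\eta\ne\nu$ implies $a_\eta\ne a_\nu$; * (b) for every $n<\omega$ and every first order formula $\varphi(x_0,\dots,x_{n-1})$ in the vocabulary of $T_1$ there is $n^*<\omega$ such that for every $k>n^*$ and all $\eta_0,\dots,\eta_{n-1},\nu_0,\dots,\nu_{n-1}\in{}^\omega2$ with $\eta_m\restriction k=\nu_m\restriction k$ for $m<n$ and $\eta_m\restriction k\ne\eta_l\restriction k$ for $m<l<n$, we have $M_1\models\varphi[a_{\eta_0},\dots,a_{\eta_{n-1}}]$ if and only if $M_1\models\varphi[a_{\nu_0},\dots,a_{\nu_{n-1}}]$. (B) Whenever $M_1$ is a model of a first order theory $T_1$ with Skolem functions and the elements $a_\eta\in M_1$ ($\eta\in{}^\omega2$) satisfy (a) and (b), then $a_\eta$ is not in the Skolem hull of $\{a_\nu:\nu\in{}^\omega2,\ \nu\ne\eta\}$, for every $\eta\in{}^\omega 2$. (C) Let $\lambda_{\omega_1}(\aleph_0)$ be the least $\lambda$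 with $\Pr_{\omega_1}(\lambda)$. Then every $\psi\in L_{\omega_1,\omega}$ in a countable vocabulary that has a model of cardinality at least $\lambda_{\omega_1}(\aleph_0)$ has a model of cardinality continuum. If moreover $\lambda_{\omega_1}(\aleph_0)<2^{\aleph_0}$, then $\lambda_{\omega_1}(\aleph_0)$ is the least cardinal with this property; that is, it is the Hanf number of $L_{\omega_1,\omega}$ below the continuum. -/

import Mathlib

open FirstOrder FirstOrder.Language
open scoped Cardinal Ordinal

universe u v w

section Rank

variable (L : FirstOrder.Language.{u, v}) {M : Type w} [L.Structure M]

/-- `a ∈ cl_{<κ}(B, M)`: some quantifier-free formula `φ(y, x₁, …, xₙ)` and `b₁, …, bₙ ∈ B` are such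
that `φ(a, b₁, …, bₙ)` holds in `M` and `φ(y, b₁, …, bₙ)` has fewer than `κ` solutions `y`. -/
def InCl (κ : Cardinal.{w}) (B : Set M) (a : M) : Prop :=
  ∃ (n : ℕ) (φ : L.Formula (Fin (n + 1))) (b : Fin n → M),
    FirstOrder.Language.BoundedFormula.IsQF φ ∧ (∀ i, b i ∈ B) ∧
    φ.Realize (Fin.cons a b : Fin (n + 1) → M) ∧
    Cardinal.mk {y : M // φ.Realize (Fin.cons y b : Fin (n + 1) → M)} < κ

open Classical in
/-- The base step: `rk⁰(w, M; <κ) ≥ 0`. -/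
def RkZero (κ : Cardinal.{w}) (s : Finset M) : Prop :=
  s.Nonempty ∧ ∀ a ∈ s, ¬ InCl L κ (↑(s.erase a) : Set M) a

open Classical in
/-- The successor step: given the predicate `P` for `rk⁰(·, M; <κ) ≥ β`, this is the predicate
`rk⁰(·, M; <κ) ≥ β + 1`.  For every enumeration `a₀, …, aₙ₋₁` of `s` without repetition, every
`k < n` and every quantifier-free `φ` true of `a₀, …, aₙ₋₁`, there are `a^i_m` (`i < 2`, `m < n`)
as required. -/
def RkSucc (P : Finset M → Prop) (s : Finset M) : Prop :=
  s.Nonempty ∧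
  ∀ (n : ℕ) (a : Fin n → M), Function.Injective a → Finset.univ.image a = s →
    ∀ (k : Fin n) (φ : L.Formula (Fin n)), FirstOrder.Language.BoundedFormula.IsQF φ →
      φ.Realize a →
      ∃ a' : Fin 2 → Fin n → M,
        P (Finset.univ.image fun p : Fin 2 × Fin n => a' p.1 p.2) ∧
        (∀ i, φ.Realize (a' i)) ∧
        a' 0 k ≠ a' 1 k ∧ (∀ m, m ≠ k → a' 0 m = a' 1 m) ∧
        (∀ m, a m = a' 0 m)

/-- `rk⁰(s, M; <κ) ≥ α`, by recursion on the ordinal `α`. -/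
noncomputable def RkGE (κ : Cardinal.{w}) (α : Ordinal.{w}) : Finset M → Prop :=
  Ordinal.limitRecOn (motive := fun _ => Finset M → Prop) α
    (RkZero L κ)
    (fun _ P => RkSucc L P)
    (fun δ _ ih s => ∀ (β : Ordinal.{w}) (h : β < δ), ih β h s)

/-- `rk⁰(s, M; <κ)`: the maximal `α` with `rk⁰(s, M; <κ) ≥ α`, which is `-1` (here `⊥`) if there is no
such `α`, and `∞` (here `⊤`) if every ordinal is such. -/
noncomputable def rk (κ : Cardinal.{w}) (s : Finset M) : WithBot (WithTop Ordinal.{w}) :=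
  sSup {x | ∃ α : Ordinal.{w}, x = ((α : WithTop Ordinal.{w}) : WithBot (WithTop Ordinal.{w})) ∧
    RkGE L κ α s}

/-- The operation `x ↦ x + 1` on ranks, with `-1 + 1 = 0` and `∞ + 1 = ∞`. -/
noncomputable def rkAddOne (x : WithBot (WithTop Ordinal.{w})) : WithTop Ordinal.{w} :=
  WithBot.recBotCoe (C := fun _ => WithTop Ordinal.{w}) 0 (fun y => y + 1) x

variable (M) in
/-- `rk⁰(M; <κ) = sup {rk⁰(s, M; <κ) + 1 : s ⊆ M finite nonempty}`. -/
noncomputable def rkModel (κ : Cardinal.{w}) : WithTop Ordinal.{w} :=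
  ⨆ s : {s : Finset M // s.Nonempty}, rkAddOne (rk L κ s.1)

end Rank

/-- `Pr_α(lam; <κ, θ)` (that is, `Pr⁰_α`): every structure on a universe of cardinality `lam` whose
vocabulary has at most `θ` symbols has `rk⁰(M; <κ) ≥ α`. -/
def PrGeneral (α : Ordinal.{u}) (lam κ θ : Cardinal.{u}) : Prop :=
  ∀ (L : FirstOrder.Language.{u, u}), L.card ≤ θ →
    ∀ (M : Type u) [L.Structure M], Cardinal.mk M = lam →
      (α : WithTop Ordinal.{u}) ≤ rkModel L M κ

/-- `Pr_α(lam)`, which abbreviates `Pr_α(lam; <ℵ₁, ℵ₀)`. -/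
def Pr (α : Ordinal.{u}) (lam : Cardinal.{u}) : Prop :=
  PrGeneral α lam (ℵ_ 1) ℵ₀

section Infinitary

/-- Formulas of `L_{ω₁,ω}` with free variables among `x₀, …, xₙ₋₁`.  Negation is `φ → ⊥`; the other
connectives, countable disjunctions and `∃` are derived. -/
inductive InfFormula (L : FirstOrder.Language.{u, v}) : ℕ → Type (max u v)
  | falsum {n : ℕ} : InfFormula L n
  | equal {n : ℕ} (t₁ t₂ : L.Term (Fin n)) : InfFormula L n
  | rel {n l : ℕ} (R : L.Relations l) (ts : Fin l → L.Term (Fin n)) : InfFormula L n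
  | imp {n : ℕ} (φ ψ : InfFormula L n) : InfFormula L n
  | conj {n : ℕ} (φ : ℕ → InfFormula L n) : InfFormula L n
  | all {n : ℕ} (φ : InfFormula L (n + 1)) : InfFormula L n

/-- Satisfaction for `L_{ω₁,ω}`. -/
def InfFormula.Realize {L : FirstOrder.Language.{u, v}} {M : Type w} [L.Structure M] :
    {n : ℕ} → InfFormula L n → (Fin n → M) → Prop
  | _, .falsum, _ => False
  | _, .equal t₁ t₂, x => t₁.realize x = t₂.realize x
  | _, .rel R ts, x => FirstOrder.Language.Structure.RelMap R fun i => (ts i).realize x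
  | _, .imp φ ψ, x => φ.Realize x → ψ.Realize x
  | _, .conj φ, x => ∀ i, (φ i).Realize x
  | _, .all φ, x => ∀ a : M, φ.Realize (Fin.snoc x a : Fin (_ + 1) → M)

/-- Sentences of `L_{ω₁,ω}`. -/
abbrev InfSentence (L : FirstOrder.Language.{u, v}) : Type (max u v) := InfFormula L 0

/-- `M ⊨ ψ` for a sentence `ψ` of `L_{ω₁,ω}`. -/
def InfSentence.Models {L : FirstOrder.Language.{u, v}} (ψ : InfSentence L) (M : Type w)
    [L.Structure M] : Prop :=
  InfFormula.Realize (M := M) ψ Fin.elim0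

end Infinitary

/-- The interpretation `R^M` of a unary predicate `R`. -/
def unaryPart {L : FirstOrder.Language.{u, v}} (R : L.Relations 1) (M : Type w) [L.Structure M] :
    Set M :=
  {x | FirstOrder.Language.Structure.RelMap R ![x]}

/-- The first order theory `T` has Skolem functions: for every formula `φ(x₀, …, xₙ₋₁, y)` there is
an `n`-place function symbol `f` with `T ⊢ ∀ x̄ (∃ y φ(x̄, y) → φ(x̄, f(x̄)))`. -/
def HasSkolemFunctions {L : FirstOrder.Language.{u, u}} (T : L.Theory) : Prop :=
  ∀ (n : ℕ) (φ : L.Formula (Fin (n + 1))), ∃ f : L.Functions n,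
    ∀ (N : FirstOrder.Language.Theory.ModelType.{u, u, u} T) (x : Fin n → N),
      (∃ y : N, φ.Realize (Fin.snoc x y : Fin (n + 1) → N)) →
        φ.Realize (Fin.snoc x (FirstOrder.Language.Structure.funMap f x) : Fin (n + 1) → N)

/-- The elements `a_η` (`η ∈ ^ω2`) are tree-indiscernible in `M`: the truth value of a first order
formula at a tuple of them depends only on `η₀ ↾ k, …, ηₙ₋₁ ↾ k`, for every large enough `k` for which
these are distinct. -/
def TreeIndiscernible (L : FirstOrder.Language.{u, v}) {M : Type w} [L.Structure M]
    (a : (ℕ → Bool) → M) : Prop :=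
  ∀ (n : ℕ) (φ : L.Formula (Fin n)), ∃ nStar : ℕ, ∀ k : ℕ, nStar < k →
    ∀ η ν : Fin n → ℕ → Bool,
      (∀ m, ∀ i < k, η m i = ν m i) →
      (∀ m l, m < l → ∃ i < k, η m i ≠ η l i) →
      (φ.Realize (fun m => a (η m)) ↔ φ.Realize (fun m => a (ν m)))

/-- `M` is the Skolem hull of the pairwise distinct, tree-indiscernible elements `a_η`
(`η ∈ ^ω2`).  (Meant for models `M` of a theory with Skolem functions, where the Skolem hull of a set
is its closure under the functions of `M`.) -/
structure TreeGenerated (L : FirstOrder.Language.{u, v}) {M : Type w} [L.Structure M]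
    (a : (ℕ → Bool) → M) : Prop where
  hull : FirstOrder.Language.Substructure.closure L (Set.range a) = ⊤
  inj : Function.Injective a
  indisc : TreeIndiscernible L a

/-- If a sentence `ψ` of `L_{ω₁,ω}` in a countable vocabulary with a unary predicate `R` has a
model `M` with `|R^M| ≥ lam`, then there are a countable first order theory `T₁` with Skolem functions,
in a vocabulary `L₁` that contains the vocabulary of `ψ`, and a model `M₁` of `T₁` and `ψ` of cardinality
continuum that is generated by tree-indiscernible `a_η ∈ R^{M₁}`, `η ∈ ^ω2`. -/
def TreeModelProperty (lam : Cardinal.{u}) : Prop :=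
  ∀ (L : FirstOrder.Language.{u, u}), L.card ≤ ℵ₀ → ∀ (R : L.Relations 1) (ψ : InfSentence L),
    (∃ (M : Type u) (_ : L.Structure M), ψ.Models M ∧ lam ≤ Cardinal.mk (unaryPart R M)) →
    ∃ (L₁ : FirstOrder.Language.{u, u}) (ι : L →ᴸ L₁) (T₁ : L₁.Theory)
      (M₁ : Type u) (_ : L.Structure M₁) (_ : L₁.Structure M₁) (a : (ℕ → Bool) → M₁),
      L₁.card ≤ ℵ₀ ∧ ι.Injective ∧ ι.IsExpansionOn M₁ ∧
      HasSkolemFunctions T₁ ∧ M₁ ⊨ T₁ ∧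
      Cardinal.mk M₁ = Cardinal.continuum ∧
      ψ.Models M₁ ∧ TreeGenerated L₁ a ∧ ∀ η, a η ∈ unaryPart R M₁

/-- Every sentence of `L_{ω₁,ω}` in a countable vocabulary that has a model of cardinality at least `μ`
has a model of cardinality continuum.  The Hanf number of `L_{ω₁,ω}` below the continuum is the
least such `μ`. -/
def ContinuumHanfBound (μ : Cardinal.{u}) : Prop :=
  ∀ (L : FirstOrder.Language.{u, u}), L.card ≤ ℵ₀ → ∀ ψ : InfSentence L,
    (∃ (M : Type u) (_ : L.Structure M), ψ.Models M ∧ μ ≤ Cardinal.mk M) →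
    ∃ (N : Type u) (_ : L.Structure N), ψ.Models N ∧ Cardinal.mk N = Cardinal.continuum

/-! ### Unfolding the recursion that defines the rank. -/

section RankFacts

variable (L : FirstOrder.Language.{u, v}) {M : Type w} [L.Structure M]

/-! Two translations of Pr carry the proof.

If Pr fails at `lam`, then on some structure of that size the ranks are bounded by a countable
ordinal. The reason why the rank of a finite tuple is no larger is one of countably many: an
ordinal, a coordinate `k`, a formula, and an integer coding a point of a countable solution set.
Taking this reason as the colour of the tuple yields a certificate (`IsRankCertificate`): two tuples
of one colour that differ only at `k` have a union of smaller rank. Such certificates come from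
`hasRankCertificate_of_not_le`, and conversely they refute Pr (`HasRankCertificate.not_pr`). The
ordinals live outside the structure, so having a certificate is a sentence of L_{ω₁,ω}. Among
tree-indiscernibles a branch can be moved slightly without changing the colour, so the ranks would
descend forever; this gives (2) ⇒ (1). Certificates also restrict to subsets, so one on a model of
size continuum refutes Pr at each cardinal below; this is the minimality in (C).

If Pr holds, choose `A` of size `lam` in R^M, expand `M` by Skolem functions and names for the
subformulas of ψ, and make all definable relations on `A` atomic. A set of tuples is large
(`IsLargeIn`) if it meets finite sets of arbitrarily high countable rank. One piece of any countable
cover of a large set is large, since ω₁ has uncountable cofinality; and every coordinate can be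
doubled, each doubling costing one rank. Alternating the two gives sets of tuples indexed by the
levels of the binary tree that decide more and more (`exists_tree_approximation`). In an ultrapower
these become the elements a_η, whose Skolem hull is the required model (`exists_tree_model`).
Deciding each formula gives (b). Deciding, for each infinite conjunction in ψ, whether it holds or
which conjunct fails omits the types that could spoil ψ (`InfFormula.realize_iff_of_omits`).

For (B), an equation expressing a_η by a term in other generators would persist when η is moved
slightly, against injectivity. -/

theorem rkGE_zero (κ : Cardinal.{w}) : RkGE L (M := M) κ 0 = RkZero L κ :=
  Ordinal.limitRecOn_zero (motive := fun _ => Finset M → Prop) _ _ _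

theorem rkGE_add_one (κ : Cardinal.{w}) (α : Ordinal.{w}) :
    RkGE L (M := M) κ (α + 1) = RkSucc L (RkGE L κ α) :=
  Ordinal.limitRecOn_add_one (motive := fun _ => Finset M → Prop) _ _ _ _

theorem rkGE_limit (κ : Cardinal.{w}) {δ : Ordinal.{w}} (hδ : Order.IsSuccLimit δ)
    (s : Finset M) : RkGE L κ δ s ↔ ∀ β < δ, RkGE L κ β s := by
  have := Ordinal.limitRecOn_limit (motive := fun _ => Finset M → Prop) δ
    (RkZero L κ) (fun _ P => RkSucc L P)
    (fun δ _ ih s => ∀ (β : Ordinal.{w}) (h : β < δ), ih β h s) hδ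
  exact iff_of_eq (congrFun this s)

/-- If nothing above `α` were attained, the rank would be at most `α`, and the rank plus one at most
`α + 1`. -/
theorem exists_rkGE_of_lt_rkAddOne {κ : Cardinal.{w}} {s : Finset M} {α : Ordinal.{w}}
    (h : ((α + 1 : Ordinal.{w}) : WithTop Ordinal.{w}) < rkAddOne (rk L κ s)) :
    ∃ β > α, RkGE L κ β s := by
  by_contra! hc
  have hle : rk L κ s ≤ ((α : WithTop Ordinal.{w}) : WithBot (WithTop Ordinal.{w})) := by
    refine sSup_le ?_
    rintro x ⟨β, rfl, hβ⟩
    have : β ≤ α := by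
      by_contra hlt
      exact hc β (not_le.1 hlt) hβ
    exact_mod_cast this
  revert h hle
  generalize rk L κ s = x
  intro h hle
  induction x using WithBot.recBotCoe with
  | bot => simp [rkAddOne] at h
  | coe y =>
    have h' : ((α + 1 : Ordinal.{w}) : WithTop Ordinal.{w}) < y + 1 := h
    have hle' : y ≤ (α : WithTop Ordinal.{w}) := by exact_mod_cast hle
    have : y + 1 ≤ (α : WithTop Ordinal.{w}) + 1 := by gcongr
    exact absurd (h'.trans_le this) (by push_cast; exact lt_irrefl _)

theorem lt_rkAddOne_of_rkGE {κ : Cardinal.{w}} {s : Finset M} {α : Ordinal.{w}}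
    (h : RkGE L κ α s) : (α : WithTop Ordinal.{w}) < rkAddOne (rk L κ s) := by
  have hle : ((α : WithTop Ordinal.{w}) : WithBot (WithTop Ordinal.{w})) ≤ rk L κ s :=
    le_sSup ⟨α, rfl, h⟩
  revert hle
  generalize rk L κ s = x
  intro hle
  induction x using WithBot.recBotCoe with
  | bot => simp at hle
  | coe y =>
    have hle' : (α : WithTop Ordinal.{w}) ≤ y := by exact_mod_cast hle
    change (α : WithTop Ordinal.{w}) < y + 1
    induction y using WithTop.recTopCoe with
    | top => simp
    | coe y =>
      have : α ≤ y := by exact_mod_cast hle'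
      have : α < y + 1 := Order.lt_add_one_iff.2 this
      exact_mod_cast this

theorem exists_rkGE_of_omega_one_le {κ : Cardinal.{w}}
    (h : ((ω₁ : Ordinal.{w}) : WithTop Ordinal.{w}) ≤ rkModel L M κ) {α : Ordinal.{w}}
    (hα : α < ω₁) : ∃ β > α, ∃ s : Finset M, s.Nonempty ∧ RkGE L κ β s := by
  have h1 : α + 1 < ω₁ := (Cardinal.isSuccLimit_omega 1).add_one_lt hα
  have h2 : ((α + 1 : Ordinal.{w}) : WithTop Ordinal.{w}) < rkModel L M κ :=
    lt_of_lt_of_le (by exact_mod_cast h1) h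
  obtain ⟨s, hs⟩ := lt_iSup_iff.1 h2
  obtain ⟨β, hβ, hr⟩ := exists_rkGE_of_lt_rkAddOne L hs
  exact ⟨β, hβ, s.1, s.2, hr⟩

theorem exists_bound_of_not_omega_one_le {κ : Cardinal.{w}}
    (h : ¬ ((ω₁ : Ordinal.{w}) : WithTop Ordinal.{w}) ≤ rkModel L M κ) :
    ∃ α < ω₁, ∀ s : Finset M, s.Nonempty → ¬ RkGE L κ α s := by
  by_contra! hc
  refine h ?_
  rw [WithTop.coe_le_iff]
  intro b hb
  by_contra hlt
  obtain ⟨s, hs, hr⟩ := hc b (not_le.1 hlt)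
  have h1 := lt_rkAddOne_of_rkGE L hr
  have h2 : rkAddOne (rk L κ s) ≤ rkModel L M κ :=
    le_iSup (fun s : {s : Finset M // s.Nonempty} => rkAddOne (rk L κ s.1)) ⟨s, hs⟩
  rw [hb] at h2
  exact absurd (h1.trans_le h2) (lt_irrefl _)

/-- This stands in for monotonicity of the rank in the ordinal: a successor is brought down to its
predecessor, a limit to `α + 1`. -/
theorem RkGE.exists_rkSucc {κ : Cardinal.{w}} {α β : Ordinal.{w}} (hαβ : α < β) {s : Finset M}
    (h : RkGE L κ β s) : ∃ γ ≥ α, RkSucc L (RkGE L κ γ) s := by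
  induction β using Ordinal.limitRecOn with
  | zero => simp at hαβ
  | add_one β _ =>
    rw [rkGE_add_one] at h
    exact ⟨β, Order.lt_add_one_iff.1 hαβ, h⟩
  | limit β hβ _ =>
    have := (rkGE_limit L κ hβ s).1 h (α + 1) (hβ.add_one_lt hαβ)
    rw [rkGE_add_one] at this
    exact ⟨α, le_rfl, this⟩

end RankFacts

/-! ### Rank certificates, and why they refute Pr. -/

section Certificates

/-- `P` certifies that ranks on `M` are bounded through the ranks `ρ` of countably many colours. -/
structure IsRankCertificate (ρ : ∀ _ : ℕ, ℕ → Ordinal.{w}) (kk : ∀ n : ℕ, ℕ → Fin (n + 1))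
    {M : Type w} (P : ∀ n : ℕ, ℕ → (Fin (n + 1) → M) → Prop) : Prop where
  total : ∀ n x, ∃ c, P n c x
  descent : ∀ n c (x : Fin (n + 1) → M) (y : M),
    Function.Injective (Fin.snoc x y : Fin (n + 2) → M) → P n c x →
    P n c (Function.update x (kk n c) y) →
    ∃ c', ρ (n + 1) c' < ρ n c ∧ P (n + 1) c' (Fin.snoc x y : Fin (n + 2) → M)

/-- `M` carries a rank certificate with ranks bounded below `ω₁`. -/
def HasRankCertificate (M : Type w) : Prop :=
  ∃ (α : Ordinal.{w}) (ρ : ∀ _ : ℕ, ℕ → Ordinal.{w}) (kk : ∀ n : ℕ, ℕ → Fin (n + 1))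
    (P : ∀ n : ℕ, ℕ → (Fin (n + 1) → M) → Prop),
    α < ω₁ ∧ (∀ n c, ρ n c ≤ α) ∧ IsRankCertificate ρ kk P

/-- Colours pull back along injections. This serves to cut a model of size continuum down to a
subset of prescribed size. -/
theorem HasRankCertificate.of_injective {M N : Type w} (f : N → M) (hf : Function.Injective f)
    (h : HasRankCertificate M) : HasRankCertificate N := by
  obtain ⟨α, ρ, kk, P, hα, hρ, hP⟩ := h
  refine ⟨α, ρ, kk, fun n c x => P n c (f ∘ x), hα, hρ, fun n x => hP.total n _, ?_⟩
  intro n c x y hinj h1 h2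
  rw [Function.comp_update] at h2
  have := hP.descent n c (f ∘ x) (f y) (by rw [← Fin.comp_snoc]; exact hf.comp hinj) h1 h2
  rwa [← Fin.comp_snoc] at this

theorem snoc_injective {M : Type*} {n : ℕ} {x : Fin n → M} {y : M}
    (hx : Function.Injective x) (hy : ∀ i, y ≠ x i) :
    Function.Injective (Fin.snoc x y : Fin (n + 1) → M) := by
  rw [Fin.snoc_injective_iff]
  exact ⟨hx, fun ⟨i, hi⟩ => hy i hi.symm⟩

section Language

/-- The relational language with symbols `c : ℕ` in every arity, and one further symbol. -/
def colourLanguage : FirstOrder.Language.{u, u} :=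
  ⟨fun _ => PEmpty, fun _ => ULift (Option ℕ)⟩

theorem colourLanguage_card : colourLanguage.{u}.card ≤ ℵ₀ := by
  rw [FirstOrder.Language.card, Cardinal.mk_le_aleph0_iff]
  unfold FirstOrder.Language.Symbols colourLanguage
  infer_instance

/-- The symbol `c` in arity `n`. -/
def colourRel (n c : ℕ) : colourLanguage.{u}.Relations n := ULift.up (some c)

/-- The structure in which `c` is interpreted by `P n c` on injective tuples. -/
abbrev injColourStructure {M : Type u} (P : ∀ n : ℕ, ℕ → (Fin (n + 1) → M) → Prop) :
    colourLanguage.{u}.Structure M where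
  funMap := fun f => f.elim
  RelMap := fun {n} R x =>
    match n, R, x with
    | n + 1, ⟨some c⟩, x => P n c x ∧ Function.Injective x
    | _, _, _ => True

end Language

/-- The colour of `x` is a quantifier-free formula, so a split at coordinate `kk n c` produces a
second tuple of the same colour; the union then has a colour of smaller rank, and induction on `β`
applies. The base clause of the rank plays no role, because `ρ n c < 0` is impossible. -/
theorem IsRankCertificate.not_rkGE {ρ : ∀ _ : ℕ, ℕ → Ordinal.{u}} {kk : ∀ n : ℕ, ℕ → Fin (n + 1)}
    {M : Type u} {P : ∀ n : ℕ, ℕ → (Fin (n + 1) → M) → Prop} (hP : IsRankCertificate ρ kk P)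
    (β : Ordinal.{u}) : ∀ (n c : ℕ) (x : Fin (n + 1) → M), Function.Injective x → P n c x →
      ρ n c < β → ∀ s : Finset M, (∀ z, z ∈ s ↔ z ∈ Set.range x) →
      ¬ @RkGE colourLanguage.{u} M (injColourStructure P) (ℵ_ 1) β s := by
  classical
  let _ := injColourStructure P
  have hreal : ∀ (n c : ℕ) (x : Fin (n + 1) → M),
      ((colourRel.{u} (n + 1) c).formula (fun i => Term.var i)).Realize x ↔
      P n c x ∧ Function.Injective x := fun n c x =>
    FirstOrder.Language.Formula.realize_rel.trans Iff.rfl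
  have hqf : ∀ n c : ℕ, FirstOrder.Language.BoundedFormula.IsQF
      ((colourRel.{u} (n + 1) c).formula (fun i : Fin (n + 1) => Term.var i)) := fun n c =>
    (FirstOrder.Language.BoundedFormula.IsAtomic.rel _ _).isQF
  -- A split does not by itself keep the second tuple injective. The injectivity built into the
  -- interpretation of colours does, and so `y` avoids all entries of `x`.
  have hnew : ∀ {n c : ℕ} {x : Fin (n + 1) → M} {y : M}, Function.Injective x →
      Function.Injective (Function.update x (kk n c) y) → y ≠ x (kk n c) →
      Function.Injective (Fin.snoc x y : Fin (n + 2) → M) := by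
    intro n c x y hx hu hy
    refine snoc_injective hx fun i hi => ?_
    by_cases hik : i = kk n c
    · exact hy (hik ▸ hi)
    · exact hik (hu (by rw [Function.update_self, Function.update_of_ne hik, hi]))
  induction β using Ordinal.limitRecOn with
  | zero =>
    intro n c x hx hc hρ
    simp at hρ
  | add_one β ih =>
    intro n c x hx hc hρ s hs h
    rw [rkGE_add_one] at h
    obtain ⟨a', ha1, ha2, ha3, ha4, ha5⟩ := h.2 (n + 1) x hx
      (by ext z; simp only [Finset.mem_image, Finset.mem_univ, true_and, hs, Set.mem_range])
      (kk n c) ((colourRel (n + 1) c).formula (fun i => Term.var i))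
      (hqf _ _) (by rw [hreal]; exact ⟨hc, hx⟩)
    have hx0 : a' 0 = x := (funext ha5).symm
    have hx1 : a' 1 = Function.update x (kk n c) (a' 1 (kk n c)) := by
      ext m
      by_cases hm : m = kk n c
      · subst hm; simp
      · rw [Function.update_of_ne hm, ← ha4 m hm, hx0]
    have h1 := (hreal _ _ _).1 (ha2 1)
    rw [hx1] at h1
    have hinj := hnew hx h1.2 (by rw [← hx0]; exact ha3.symm)
    obtain ⟨c', hc', hPc'⟩ := hP.descent n c x _ hinj hc h1.1
    refine ih (n + 1) c' _ hinj hPc' (hc'.trans_le (Order.lt_add_one_iff.1 hρ)) _ ?_ ha1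
    intro z
    have hl : z ∈ Set.range (Fin.snoc x (a' 1 (kk n c)) : Fin (n + 2) → M) ↔
        (∃ i, x i = z) ∨ a' 1 (kk n c) = z := by
      rw [Set.mem_range, Fin.exists_fin_succ']
      simp only [Fin.snoc_castSucc, Fin.snoc_last]
    rw [hl]
    simp only [Finset.mem_image, Finset.mem_univ, true_and, Prod.exists, Fin.exists_fin_two]
    rw [hx0]
    constructor
    · rintro (⟨i, hi⟩ | ⟨i, hi⟩)
      · exact Or.inl ⟨i, hi⟩
      · by_cases hm : i = kk n c
        · exact Or.inr (hm ▸ hi)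
        · exact Or.inl ⟨i, by rw [← hi, ← ha4 i hm, hx0]⟩
    · rintro (⟨i, hi⟩ | hi)
      · exact Or.inl ⟨i, hi⟩
      · exact Or.inr ⟨_, hi⟩
  | limit β hβ ih =>
    intro n c x hx hc hρ s hs h
    rw [rkGE_limit _ _ hβ] at h
    have hlt := hβ.add_one_lt hρ
    exact ih _ hlt n c x hx hc (Order.lt_add_one_iff.2 le_rfl) s hs (h _ hlt)

theorem exists_fin_enum {M : Type*} {s : Finset M} (hs : s.Nonempty) :
    ∃ (n : ℕ) (x : Fin (n + 1) → M), Function.Injective x ∧ ∀ z, z ∈ s ↔ z ∈ Set.range x := by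
  obtain ⟨n, hn⟩ : ∃ n, s.card = n + 1 := ⟨s.card - 1, by have := hs.card_pos; omega⟩
  refine ⟨n, fun i => (s.equivFinOfCardEq hn).symm i, ?_, ?_⟩
  · exact Subtype.val_injective.comp (Equiv.injective _)
  · intro z
    constructor
    · intro hz
      exact ⟨s.equivFinOfCardEq hn ⟨z, hz⟩, by simp⟩
    · rintro ⟨i, rfl⟩
      exact ((s.equivFinOfCardEq hn).symm i).2

theorem HasRankCertificate.not_pr {M : Type u} (h : HasRankCertificate M) :
    ¬ Pr ω₁ (Cardinal.mk M) := by
  intro hpr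
  obtain ⟨α, ρ, kk, P, hα, hρ, hP⟩ := h
  let _ := injColourStructure P
  have h1 := hpr colourLanguage colourLanguage_card M rfl
  obtain ⟨β, hβ, s, hs, hr⟩ := exists_rkGE_of_omega_one_le _ h1 hα
  obtain ⟨n, x, hx, hsx⟩ := exists_fin_enum hs
  obtain ⟨c, hc⟩ := hP.total n x
  exact hP.not_rkGE β n c x hx hc ((hρ n c).trans_lt hβ) s hsx hr

end Certificates

/-! ### From a countable bound on the ranks to a certificate. -/

section ToCertificate

theorem countable_formula {L : FirstOrder.Language.{u, u}} (hL : L.card ≤ ℵ₀)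
    (α : Type) [Countable α] : Countable (L.Formula α) := by
  rw [← Cardinal.mk_le_aleph0_iff]
  have h1 : Cardinal.mk (L.Formula α) ≤
      Cardinal.mk (Σ k, L.BoundedFormula (ULift.{u} α) k) := by
    refine Cardinal.mk_le_of_injective
      (f := fun φ => ⟨0, FirstOrder.Language.BoundedFormula.relabelEquiv Equiv.ulift.symm φ⟩) ?_
    intro φ ψ h
    simpa using h
  refine h1.trans (FirstOrder.Language.BoundedFormula.card_le.trans ?_)
  simp only [max_le_iff, le_refl, true_and]
  refine Cardinal.add_le_aleph0.2 ⟨?_, by simpa using hL⟩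
  simp

theorem countable_Iic_of_lt_omega_one {α : Ordinal.{u}} (hα : α < ω₁) :
    Countable (Set.Iic α) := by
  have h : α.card ≤ ℵ₀ := by
    rw [← Order.lt_succ_iff, ← Cardinal.aleph_zero, Cardinal.succ_aleph, zero_add]
    rw [← Cardinal.lt_ord, Cardinal.ord_aleph]
    simpa using hα
  have h2 : (Order.succ α).card ≤ ℵ₀ := by
    simpa using h
  rw [← Order.Iio_succ]
  rw [← Cardinal.mk_le_aleph0_iff, Cardinal.mk_Iio_ordinal]
  exact Cardinal.lift_le_aleph0.2 h2

variable {L : FirstOrder.Language.{u, u}} {M : Type u} [L.Structure M]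

/-- The least `γ` with `rk(s, M; <ℵ₁) ≱ γ`. -/
noncomputable def rankBound (L : FirstOrder.Language.{u, u}) {M : Type u} [L.Structure M]
    (s : Finset M) : Ordinal.{u} :=
  sInf {γ | ¬ RkGE L (ℵ_ 1) γ s}

theorem rankBound_le {s : Finset M} {γ : Ordinal.{u}} (h : ¬ RkGE L (ℵ_ 1) γ s) :
    rankBound L s ≤ γ := csInf_le' h

theorem not_rkGE_rankBound {s : Finset M} {γ : Ordinal.{u}} (h : ¬ RkGE L (ℵ_ 1) γ s) :
    ¬ RkGE L (ℵ_ 1) (rankBound L s) s := csInf_mem (s := {γ | ¬ RkGE L (ℵ_ 1) γ s}) ⟨γ, h⟩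

/-- The first failure cannot occur at a limit, where the clause is the conjunction of the earlier
ones. -/
theorem rankBound_cases {s : Finset M} {γ : Ordinal.{u}} (h : ¬ RkGE L (ℵ_ 1) γ s) :
    (rankBound L s = 0 ∧ ¬ RkZero L (ℵ_ 1) s) ∨
    ∃ β, rankBound L s = β + 1 ∧ ¬ RkSucc L (RkGE L (ℵ_ 1) β) s := by
  have h1 := not_rkGE_rankBound h
  have hmin : ∀ β < rankBound L s, RkGE L (ℵ_ 1) β s := fun β hβ => by
    by_contra hc
    exact absurd (rankBound_le hc) (not_le.2 hβ)
  generalize rankBound L s = δ at *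
  induction δ using Ordinal.limitRecOn with
  | zero => exact Or.inl ⟨rfl, by rwa [rkGE_zero] at h1⟩
  | add_one β _ => exact Or.inr ⟨β, rfl, by rwa [rkGE_add_one] at h1⟩
  | limit δ hδ _ => exact absurd ((rkGE_limit L _ hδ s).2 hmin) h1

open Classical in
/-- A map to `ℕ` that is injective on `D` if `D` is countable. -/
noncomputable def codeOn {M : Type u} (D : Set M) : M → ℕ :=
  if h : ∃ f : M → ℕ, D.InjOn f then h.choose else fun _ => 0

theorem codeOn_injOn {M : Type u} {D : Set M} (hD : D.Countable) : D.InjOn (codeOn D) := by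
  have h : ∃ f : M → ℕ, D.InjOn f := Set.countable_iff_exists_injOn.1 hD
  rw [codeOn, dif_pos h]
  exact h.choose_spec

open Classical in
/-- The range of a finite tuple as a finite set. -/
noncomputable def finRange {M : Type u} {n : ℕ} (x : Fin n → M) : Finset M := Finset.univ.image x

theorem mem_finRange {n : ℕ} {x : Fin n → M} {z : M} : z ∈ finRange x ↔ ∃ i, x i = z := by
  simp [finRange]

/-- The solutions of `φ` in place of the `k`-th entry of `x`. -/
def fibre {n : ℕ} (φ : L.Formula (Fin n)) (k : Fin n) (x : Fin n → M) : Set M :=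
  {z | φ.Realize (Function.update x k z)}

/-- The data `γ`, `k`, `φ`, `m` witness that the rank of the range of `x` is not at least `γ`. -/
def RankWitness {n : ℕ} (γ : Ordinal.{u}) (k : Fin n) (φ : L.Formula (Fin n)) (m : ℕ)
    (x : Fin n → M) : Prop :=
  φ.Realize x ∧ ((γ = 0 ∧ (fibre φ k x).Countable ∧ codeOn (fibre φ k x) (x k) = m) ∨
    ∃ β, γ = β + 1 ∧ ∀ y, Function.Injective (Fin.snoc x y : Fin (n + 1) → M) →
      φ.Realize (Function.update x k y) →
      ¬ RkGE L (ℵ_ 1) β (finRange (Fin.snoc x y : Fin (n + 1) → M)))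

/-- A failure of either clause for the set becomes a statement about the given enumeration `x`: the
parameters of a closure formula are entries of `x` other than `x k`, and a failed splitting moves
along the bijection between two enumerations. Relabelling variables does both. -/
theorem exists_rankWitness {n : ℕ} (x : Fin n → M) (hx : Function.Injective x)
    (hn : 0 < n) {γ : Ordinal.{u}} (h : ¬ RkGE L (ℵ_ 1) γ (finRange x)) :
    ∃ (k : Fin n) (φ : L.Formula (Fin n)) (m : ℕ),
      RankWitness (rankBound L (finRange x)) k φ m x := by
  classical
  have hne : (finRange x).Nonempty := ⟨x ⟨0, hn⟩, mem_finRange.2 ⟨_, rfl⟩⟩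
  rcases rankBound_cases h with ⟨h0, hz⟩ | ⟨β, hβ, hs⟩
  · rw [h0]
    simp only [RkZero, hne, true_and, not_forall, not_not] at hz
    obtain ⟨a, ha, l, φ, b, -, hb, hφ, hcard⟩ := hz
    obtain ⟨k, rfl⟩ := mem_finRange.1 ha
    have hb' : ∀ i, ∃ j, j ≠ k ∧ x j = b i := by
      intro i
      have := hb i
      simp only [Finset.coe_erase, Set.mem_sdiff, Finset.mem_coe, mem_finRange,
        Set.mem_singleton_iff] at this
      obtain ⟨⟨j, hj⟩, hjk⟩ := this
      exact ⟨j, fun h => hjk (by rw [← hj, h]), hj⟩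
    choose j hjk hj using hb'
    have hre : ∀ y : M, ((FirstOrder.Language.Formula.relabel
        (Fin.cons k j : Fin (l + 1) → Fin n) φ).Realize (Function.update x k y) ↔
        φ.Realize (Fin.cons y b : Fin (l + 1) → M)) := by
      intro y
      rw [FirstOrder.Language.Formula.realize_relabel]
      refine iff_of_eq (congrArg _ ?_)
      ext i
      refine Fin.cases ?_ (fun i => ?_) i
      · simp
      · simp [Function.update_of_ne (hjk i), hj]
    refine ⟨k, FirstOrder.Language.Formula.relabel (Fin.cons k j : Fin (l + 1) → Fin n) φ, _,
      ?_, Or.inl ⟨rfl, ?_, rfl⟩⟩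
    · have := (hre (x k)).2 hφ
      rwa [Function.update_eq_self] at this
    · have : fibre (FirstOrder.Language.Formula.relabel
          (Fin.cons k j : Fin (l + 1) → Fin n) φ) k x =
          {y | φ.Realize (Fin.cons y b : Fin (l + 1) → M)} := Set.ext hre
      rw [this, ← Cardinal.le_aleph0_iff_set_countable, ← Order.lt_succ_iff,
        ← Cardinal.aleph_zero, Cardinal.succ_aleph, zero_add]
      exact hcard
  · rw [hβ]
    simp only [RkSucc, hne, true_and, not_forall] at hs
    obtain ⟨n', a, ha, has, k, φ, -, hφ, hno⟩ := hs
    have hae : ∀ i, ∃ j, x j = a i := fun i => by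
      rw [← mem_finRange, ← has]
      simp
    choose e he using hae
    have hcomp : x ∘ e = a := funext he
    have hei : Function.Injective e := fun i j hij => ha (by rw [← he, ← he, hij])
    have hes : Function.Surjective e := by
      intro i
      have : x i ∈ Finset.univ.image a := by rw [has]; exact mem_finRange.2 ⟨i, rfl⟩
      obtain ⟨j, -, hj⟩ := Finset.mem_image.1 this
      exact ⟨j, hx (by rw [he, hj])⟩
    refine ⟨e k, φ.relabel e, 0, ?_, Or.inr ⟨β, rfl, ?_⟩⟩
    · rwa [FirstOrder.Language.Formula.realize_relabel, hcomp]
    · intro y hy hφy hr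
      rw [FirstOrder.Language.Formula.realize_relabel,
        Function.update_comp_eq_of_injective _ hei, hcomp] at hφy
      -- The forbidden split consists of `a` and its update by `y`; the two tuples together cover
      -- exactly the range of `Fin.snoc x y`.
      refine hno ⟨![a, Function.update a k y], ?_, ?_, ?_, ?_, fun _ => rfl⟩
      · convert hr using 1
        ext z
        rw [mem_finRange, Fin.exists_fin_succ']
        simp only [Fin.snoc_castSucc, Fin.snoc_last, Finset.mem_image, Finset.mem_univ, true_and,
          Prod.exists, Fin.exists_fin_two, Matrix.cons_val_zero, Matrix.cons_val_one]
        constructor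
        · rintro (⟨i, hi⟩ | ⟨i, hi⟩)
          · exact Or.inl ⟨e i, by rw [he, hi]⟩
          · by_cases hik : i = k
            · subst hik
              exact Or.inr (by simpa using hi)
            · rw [Function.update_of_ne hik] at hi
              exact Or.inl ⟨e i, by rw [he, hi]⟩
        · rintro (⟨i, hi⟩ | hi)
          · obtain ⟨j, rfl⟩ := hes i
            exact Or.inl ⟨j, by rw [← he, hi]⟩
          · exact Or.inr ⟨k, by simpa using hi⟩
      · intro i
        fin_cases i
        · exact hφ
        · exact hφy
      · intro h
        have h' : a k = y := by simpa using h
        have := hy (a₁ := (e k).castSucc) (a₂ := Fin.last n)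
          (by rw [Fin.snoc_castSucc, Fin.snoc_last, he, h'])
        exact absurd this (Fin.castSucc_lt_last _).ne
      · intro m hm
        simp [Function.update_of_ne hm]

/-- For `γ = 0` the situation is contradictory: `x k` and `y` lie in one countable fibre and have
the same code, so they coincide. For `γ = β + 1`, the tuple and its update would form a split of the
forbidden kind unless their union fails rank `β`. -/
theorem RankWitness.descent {n : ℕ} {γ : Ordinal.{u}} {k : Fin n} {φ : L.Formula (Fin n)} {m : ℕ}
    {x : Fin n → M} {y : M} (hy : Function.Injective (Fin.snoc x y : Fin (n + 1) → M))
    (h1 : RankWitness γ k φ m x) (h2 : RankWitness γ k φ m (Function.update x k y)) :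
    ∃ β < γ, ¬ RkGE L (ℵ_ 1) β (finRange (Fin.snoc x y : Fin (n + 1) → M)) := by
  rcases h1.2 with ⟨hγ, hc, hm⟩ | ⟨β, rfl, hβ⟩
  · rcases h2.2 with ⟨-, -, hm'⟩ | ⟨β, hβ, -⟩
    · have hf : fibre φ k (Function.update x k y) = fibre φ k x := by
        ext z
        simp [fibre]
      rw [hf, Function.update_self] at hm'
      have hxk : x k ∈ fibre φ k x := by
        simpa [fibre] using h1.1
      have := codeOn_injOn hc hxk (show y ∈ fibre φ k x from h2.1) (hm.trans hm'.symm)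
      have := hy (a₁ := k.castSucc) (a₂ := Fin.last n)
        (by rw [Fin.snoc_castSucc, Fin.snoc_last, this])
      exact absurd this (Fin.castSucc_lt_last _).ne
    · rw [hγ] at hβ
      exact absurd hβ.symm (by simp)
  · exact ⟨β, Order.lt_add_one_iff.2 le_rfl, hβ y hy h2.1⟩

theorem hasRankCertificate_of_not_le (hL : L.card ≤ ℵ₀)
    (h : ¬ ((ω₁ : Ordinal.{u}) : WithTop Ordinal.{u}) ≤ rkModel L M (ℵ_ 1)) :
    HasRankCertificate M := by
  obtain ⟨α, hα, hα'⟩ := exists_bound_of_not_omega_one_le L h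
  -- The colours are quadruples of rank bound, coordinate, formula and code. There are countably
  -- many because `α < ω₁` and the vocabulary is countable.
  have hcount : ∀ n, ∃ f : ℕ → Set.Iic α × Fin (n + 1) × L.Formula (Fin (n + 1)) × ℕ,
      Function.Surjective f := fun n => by
    have := countable_formula hL (Fin (n + 1))
    have := countable_Iic_of_lt_omega_one hα
    have : Nonempty (Set.Iic α) := ⟨⟨α, Set.mem_Iic.2 le_rfl⟩⟩
    exact exists_surjective_nat _
  choose f hf using hcount
  have hne : ∀ {n : ℕ} (x : Fin (n + 1) → M), (finRange x).Nonempty := fun x =>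
    ⟨x 0, mem_finRange.2 ⟨_, rfl⟩⟩
  have htot : ∀ {n : ℕ} (x : Fin (n + 1) → M), Function.Injective x →
      ∃ c, ((f n c).1 : Ordinal) = rankBound L (finRange x) ∧
        RankWitness (f n c).1.1 (f n c).2.1 (f n c).2.2.1 (f n c).2.2.2 x := by
    intro n x hx
    have hb := hα' _ (hne x)
    obtain ⟨k, φ, m, hw⟩ := exists_rankWitness x hx n.succ_pos hb
    obtain ⟨c, hc⟩ := hf n ⟨⟨rankBound L (finRange x), rankBound_le hb⟩, k, φ, m⟩
    exact ⟨c, by rw [hc], by rw [hc]; exact hw⟩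
  -- Tuples with repetitions carry every colour vacuously; descent concerns injective tuples only.
  refine ⟨α, fun n c => (f n c).1, fun n c => (f n c).2.1, fun n c x => Function.Injective x →
    RankWitness (f n c).1.1 (f n c).2.1 (f n c).2.2.1 (f n c).2.2.2 x, hα, fun n c => (f n c).1.2,
    ⟨?_, ?_⟩⟩
  · intro n x
    by_cases hx : Function.Injective x
    · obtain ⟨c, -, hc⟩ := htot x hx
      exact ⟨c, fun _ => hc⟩
    · exact ⟨0, fun h => absurd h hx⟩
  · intro n c x y hy h1 h2
    have hx : Function.Injective x := (Fin.snoc_injective_iff.1 hy).1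
    have hyx : ∀ i, y ≠ x i := fun i hi => (Fin.snoc_injective_iff.1 hy).2 ⟨i, hi.symm⟩
    have hu : Function.Injective (Function.update x (f n c).2.1 y) := by
      intro i j hij
      by_cases hi : i = (f n c).2.1 <;> by_cases hj : j = (f n c).2.1
      · rw [hi, hj]
      · rw [hi, Function.update_self, Function.update_of_ne hj] at hij
        exact absurd hij (hyx _)
      · rw [hj, Function.update_self, Function.update_of_ne hi] at hij
        exact absurd hij.symm (hyx _)
      · rw [Function.update_of_ne hi, Function.update_of_ne hj] at hij
        exact hx hij
    obtain ⟨β, hβ, hr⟩ := (h1 hx).descent hy (h2 hu)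
    obtain ⟨c', hc', hw⟩ := htot _ hy
    exact ⟨c', hc'.trans_lt ((rankBound_le hr).trans_lt hβ), fun _ => hw⟩

theorem exists_hasRankCertificate_of_not_pr {lam : Cardinal.{u}} (h : ¬ Pr ω₁ lam) :
    ∃ M : Type u, Cardinal.mk M = lam ∧ HasRankCertificate M := by
  simp only [Pr, PrGeneral, not_forall] at h
  obtain ⟨L, hL, M, _, hM, h⟩ := h
  exact ⟨M, hM, hasRankCertificate_of_not_le hL h⟩

end ToCertificate

/-! ### Certificates as sentences of L_{ω₁,ω}. -/

section Expressible

/-- The property `Q` of `n`-tuples is expressed by a formula of `L_{ω₁,ω}`. -/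
def InfExpressible (L : FirstOrder.Language.{u, u}) (n : ℕ)
    (Q : ∀ (M : Type u) [L.Structure M], (Fin n → M) → Prop) : Prop :=
  ∃ θ : InfFormula L n, ∀ (M : Type u) [L.Structure M] (x : Fin n → M), θ.Realize x ↔ Q M x

namespace InfExpressible

variable {L : FirstOrder.Language.{u, u}} {n : ℕ}
  {Q Q' : ∀ (M : Type u) [L.Structure M], (Fin n → M) → Prop}

theorem rel {l : ℕ} (R : L.Relations l) (e : Fin l → Fin n) :
    InfExpressible L n (fun _ _ x => FirstOrder.Language.Structure.RelMap R (x ∘ e)) :=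
  ⟨.rel R fun i => Term.var (e i), fun _ _ _ => Iff.rfl⟩

theorem eq (i j : Fin n) : InfExpressible L n (fun _ _ x => x i = x j) :=
  ⟨.equal (Term.var i) (Term.var j), fun _ _ _ => Iff.rfl⟩

theorem imp (h : InfExpressible L n Q) (h' : InfExpressible L n Q') :
    InfExpressible L n (fun M _ x => Q M x → Q' M x) := by
  obtain ⟨θ, hθ⟩ := h
  obtain ⟨θ', hθ'⟩ := h'
  exact ⟨.imp θ θ', fun M _ x => imp_congr (hθ M x) (hθ' M x)⟩

theorem const (p : Prop) : InfExpressible L n (fun _ _ _ => p) := by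
  by_cases hp : p
  · exact ⟨.imp .falsum .falsum, fun _ _ _ => iff_of_true id hp⟩
  · exact ⟨.falsum, fun _ _ _ => iff_of_false id hp⟩

theorem not (h : InfExpressible L n Q) : InfExpressible L n (fun M _ x => ¬ Q M x) :=
  h.imp (const False)

theorem forall_countable {ι : Type*} [Countable ι]
    {F : ι → ∀ (M : Type u) [L.Structure M], (Fin n → M) → Prop}
    (h : ∀ i, InfExpressible L n (F i)) :
    InfExpressible L n (fun M _ x => ∀ i, F i M x) := by
  rcases isEmpty_or_nonempty ι with hι | hι
  · obtain ⟨θ, hθ⟩ := const (L := L) (n := n) True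
    exact ⟨θ, fun M _ x => (hθ M x).trans (iff_of_true trivial fun i => hι.elim i)⟩
  · obtain ⟨f, hf⟩ := exists_surjective_nat ι
    choose θ hθ using h
    exact ⟨.conj fun k => θ (f k), fun M _ x =>
      ⟨fun hx i => by
        obtain ⟨k, rfl⟩ := hf i
        exact (hθ _ M x).1 (hx k), fun hx k => (hθ _ M x).2 (hx _)⟩⟩

theorem congr (h : InfExpressible L n Q)
    (hQ : ∀ (M : Type u) [L.Structure M] (x : Fin n → M), Q M x ↔ Q' M x) :
    InfExpressible L n Q' := by
  obtain ⟨θ, hθ⟩ := h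
  exact ⟨θ, fun M _ x => (hθ M x).trans (hQ M x)⟩

theorem exists_countable {ι : Type*} [Countable ι]
    {F : ι → ∀ (M : Type u) [L.Structure M], (Fin n → M) → Prop}
    (h : ∀ i, InfExpressible L n (F i)) :
    InfExpressible L n (fun M _ x => ∃ i, F i M x) :=
  (forall_countable fun i => (h i).not).not.congr fun M _ x => by simp

theorem and (h : InfExpressible L n Q) (h' : InfExpressible L n Q') :
    InfExpressible L n (fun M _ x => Q M x ∧ Q' M x) :=
  (h.imp h'.not).not.congr fun M _ x => by simp

theorem injective : InfExpressible L n (fun _ _ x => Function.Injective x) :=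
  forall_countable fun i => forall_countable fun j => (eq i j).imp (const (i = j))

theorem all {Q : ∀ (M : Type u) [L.Structure M], (Fin (n + 1) → M) → Prop}
    (h : InfExpressible L (n + 1) Q) : InfExpressible L n
      (fun M _ x => ∀ y : M, Q M (Fin.snoc x y : Fin (n + 1) → M)) := by
  obtain ⟨θ, hθ⟩ := h
  exact ⟨.all θ, fun M _ x => forall_congr' fun y => hθ M _⟩

theorem alls {n : ℕ} {Q : ∀ (M : Type u) [L.Structure M], (Fin n → M) → Prop}
    (h : InfExpressible L n Q) : InfExpressible L 0 (fun M _ _ => ∀ x : Fin n → M, Q M x) := by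
  induction n with
  | zero => exact h.congr fun M _ x =>
      ⟨fun hx y => by rwa [Subsingleton.elim y x], fun hx => hx x⟩
  | succ n ih => exact (ih h.all).congr fun M _ _ =>
      ⟨fun hx y => by simpa using hx (Fin.init y) (y (Fin.last n)), fun hx y z => hx _⟩

end InfExpressible

/-- The relations on `M` that interpret the colours. -/
def colourRelations (M : Type u) [colourLanguage.{u}.Structure M] (n c : ℕ)
    (x : Fin (n + 1) → M) : Prop :=
  FirstOrder.Language.Structure.RelMap (colourRel.{u} (n + 1) c) x

/-- The data `ρ` and `kk` are external, so each comparison of ordinals is a constant truth value,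
and the only infinitary ingredients are countable quantifications over arities and colours. -/
theorem exists_certificate_sentence (ρ : ∀ _ : ℕ, ℕ → Ordinal.{u})
    (kk : ∀ n : ℕ, ℕ → Fin (n + 1)) :
    ∃ ψ : InfSentence colourLanguage.{u}, ∀ (M : Type u) [colourLanguage.{u}.Structure M],
      ψ.Models M ↔ IsRankCertificate ρ kk (colourRelations M) := by
  obtain ⟨ψ, hψ⟩ : InfExpressible colourLanguage.{u} 0 (fun M _ _ =>
      ∀ n : ℕ, (∀ x : Fin (n + 1) → M, ∃ c, colourRelations M n c (x ∘ id)) ∧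
        ∀ c, ∀ x : Fin (n + 2) → M, Function.Injective x →
          colourRelations M n c (x ∘ Fin.castSucc) →
          colourRelations M n c (x ∘ Function.update Fin.castSucc (kk n c) (Fin.last _)) →
          ∃ c', ρ (n + 1) c' < ρ n c ∧ colourRelations M (n + 1) c' (x ∘ id)) :=
    .forall_countable fun n => .and (.alls (.exists_countable fun c => .rel _ _))
      (.forall_countable fun c => .alls (.imp .injective (.imp (.rel _ _) (.imp (.rel _ _)
        (.exists_countable fun c' => .and (.const _) (.rel _ _))))))
  refine ⟨ψ, fun M _ => (hψ M _).trans ⟨fun h => ⟨fun n => (h n).1, ?_⟩, fun h n =>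
    ⟨h.total n, ?_⟩⟩⟩
  · intro n c x y hy h1 h2
    refine (h n).2 c _ hy ?_ ?_
    · convert h1 using 1
      ext i
      simp
    · convert h2 using 1
      rw [Function.comp_update]
      congr 1
      · ext i
        simp
      · simp
  · intro c x hx h1 h2
    obtain ⟨y, z, rfl⟩ : ∃ (y : Fin (n + 1) → M) (z : M), (Fin.snoc y z : Fin (n + 2) → M) = x :=
      ⟨Fin.init x, x (Fin.last _), Fin.snoc_init_self x⟩
    refine h.descent n c y z hx ?_ ?_
    · convert h1 using 1
      ext i
      simp
    · convert h2 using 1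
      rw [Function.comp_update]
      congr 1
      · ext i
        simp
      · simp

/-- The structure in which `c` is interpreted by `P n c`. -/
abbrev colourStructure {M : Type u} (P : ∀ n : ℕ, ℕ → (Fin (n + 1) → M) → Prop) :
    colourLanguage.{u}.Structure M where
  funMap := fun f => f.elim
  RelMap := fun {n} R x =>
    match n, R, x with
    | n + 1, ⟨some c⟩, x => P n c x
    | _, _, _ => True

theorem HasRankCertificate.exists_sentence {M : Type u} (h : HasRankCertificate M) :
    ∃ (α : Ordinal.{u}) (ρ : ∀ _ : ℕ, ℕ → Ordinal.{u}) (kk : ∀ n : ℕ, ℕ → Fin (n + 1))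
      (ψ : InfSentence colourLanguage.{u}) (R : colourLanguage.{u}.Relations 1)
      (_ : colourLanguage.{u}.Structure M), α < ω₁ ∧ (∀ n c, ρ n c ≤ α) ∧
      (∀ (N : Type u) [colourLanguage.{u}.Structure N],
        ψ.Models N ↔ IsRankCertificate ρ kk (colourRelations N)) ∧
      ψ.Models M ∧ unaryPart R M = Set.univ := by
  obtain ⟨α, ρ, kk, P, hα, hρ, hP⟩ := h
  obtain ⟨ψ, hψ⟩ := exists_certificate_sentence ρ kk
  let _ := colourStructure P
  exact ⟨α, ρ, kk, ψ, ULift.up none, inferInstance, hα, hρ, hψ, (hψ M).2 hP,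
    Set.eq_univ_of_forall fun x => trivial⟩

end Expressible

/-! ### Consequences of tree-indiscernibility; (2) implies (1), part (B), and minimality. -/

section TreeContradiction

theorem exists_distinguishing_level {n : ℕ} (η : Fin n → ℕ → Bool) :
    ∃ N : ℕ, ∀ k ≥ N, ∀ m l, η m ≠ η l → ∃ i < k, η m i ≠ η l i := by
  have h : ∀ m l, ∃ N, η m ≠ η l → ∃ i < N, η m i ≠ η l i := by
    intro m l
    by_cases hml : η m = η l
    · exact ⟨0, fun h => absurd hml h⟩
    · obtain ⟨i, hi⟩ := Function.ne_iff.1 hml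
      exact ⟨i + 1, fun _ => ⟨i, i.lt_succ_self, hi⟩⟩
  choose N hN using h
  refine ⟨Finset.univ.sup fun m => Finset.univ.sup (N m), fun k hk m l hml => ?_⟩
  obtain ⟨i, hi, hne⟩ := hN m l hml
  refine ⟨i, hi.trans_le (le_trans ?_ hk), hne⟩
  exact (Finset.le_sup (f := N m) (Finset.mem_univ l)).trans
    (Finset.le_sup (f := fun m => Finset.univ.sup (N m)) (Finset.mem_univ m))

theorem exists_near_branch (η : ℕ → Bool) (k : ℕ) :
    ∃ ν : ℕ → Bool, ν ≠ η ∧ ∀ i < k, ν i = η i :=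
  ⟨Function.update η k (!η k), fun h => by simpa using congrFun h k,
    fun i hi => Function.update_of_ne hi.ne _ _⟩

/-- Replacing one branch of a tuple by a nearby different one does not affect a formula. -/
theorem TreeIndiscernible.exists_update {L : FirstOrder.Language.{u, v}} {M : Type w}
    [L.Structure M] {a : (ℕ → Bool) → M} (ha : TreeIndiscernible L a) {n : ℕ}
    (φ : L.Formula (Fin n)) (η : Fin n → ℕ → Bool) (hη : Function.Injective η) (k : Fin n) :
    ∃ ν : ℕ → Bool, (∀ m, ν ≠ η m) ∧
      (φ.Realize (a ∘ η) ↔ φ.Realize (Function.update (a ∘ η) k (a ν))) := by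
  obtain ⟨N, hN⟩ := exists_distinguishing_level η
  obtain ⟨N', hN'⟩ := ha n φ
  -- The agreement level must both separate the branches of `η` (`N`) and exceed the threshold for
  -- `φ` (`N'`).
  obtain ⟨ν, hν, hν'⟩ := exists_near_branch (η k) (max N (N' + 1))
  refine ⟨ν, fun m hm => ?_, ?_⟩
  · by_cases hmk : m = k
    · exact hν (hmk ▸ hm)
    · obtain ⟨i, hi, hne⟩ := hN _ (le_max_left _ (N' + 1)) m k (hη.ne hmk)
      exact hne (by rw [← hm, hν' i hi])
  · rw [← Function.comp_update]
    refine hN' (max N (N' + 1)) (lt_of_lt_of_le N'.lt_succ_self (le_max_right _ _)) η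
      (Function.update η k ν) ?_ ?_
    · intro m i hi
      by_cases hmk : m = k
      · subst hmk
        rw [Function.update_self, hν' i hi]
      · rw [Function.update_of_ne hmk]
    · intro m l hml
      exact hN _ (le_max_left _ _) m l (hη.ne hml.ne)

/-- If a term in the other generators had value `a η`, the equation would survive moving the last
branch to a nearby `ν`, giving `a ν = a η`. -/
theorem TreeGenerated.notMem_closure {L : FirstOrder.Language.{u, u}} {M : Type u}
    [L.Structure M] {a : (ℕ → Bool) → M} (ha : TreeGenerated L a) (η : ℕ → Bool) :
    a η ∉ FirstOrder.Language.Substructure.closure L (a '' {ν | ν ≠ η}) := by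
  intro hmem
  rw [FirstOrder.Language.Substructure.mem_closure_iff_exists_term] at hmem
  obtain ⟨t, ht⟩ := hmem
  classical
  have hpre : ∀ z : (a '' {ν | ν ≠ η} : Set M), ∃ ν, ν ≠ η ∧ a ν = z := fun z => z.2
  choose g hg hag using hpre
  set s := t.varFinset.image g with hs
  set n := s.card
  set e := s.equivFin
  have hgs : ∀ z : t.varFinset, g z ∈ s := fun z => Finset.mem_image_of_mem _ z.2
  set ζ : Fin (n + 1) → ℕ → Bool := Fin.snoc (fun i => (e.symm i).1) η with hζ
  have hinj : Function.Injective ζ := by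
    refine snoc_injective (Subtype.val_injective.comp e.symm.injective) fun i hi => ?_
    have : η ∈ s := by rw [hi]; exact (e.symm i).2
    obtain ⟨z, -, hz⟩ := Finset.mem_image.1 this
    exact hg z hz
  set φ : L.Formula (Fin (n + 1)) :=
    (t.restrictVar fun z => (e ⟨g z, hgs z⟩).castSucc).equal (Term.var (Fin.last n)) with hφ
  have hreal : ∀ y, φ.Realize (Function.update (a ∘ ζ) (Fin.last n) y) ↔ a η = y := by
    intro y
    rw [hφ, FirstOrder.Language.Formula.realize_equal]
    rw [Term.realize_var, Function.update_self, ← ht]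
    rw [FirstOrder.Language.Term.realize_restrictVar (v' := ((↑) : (a '' {ν | ν ≠ η} : Set M) → M))]
    intro z
    rw [Function.update_of_ne (Fin.castSucc_lt_last _).ne]
    simp [hζ, hag]
  obtain ⟨ν, hν, hiff⟩ := ha.indisc.exists_update φ ζ hinj (Fin.last n)
  rw [hreal, ← Function.update_eq_self (Fin.last n) (a ∘ ζ), hreal] at hiff
  have h1 : ζ (Fin.last n) = η := by simp [hζ]
  have := ha.inj (hiff.1 (by simp [h1]))
  exact hν (Fin.last n) (by rw [h1, this])

/-- By well-founded induction on `γ`, no injective tuple of branches has a colour of rank `γ`: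
moving branch `kk n c` keeps the colour, and descent gives a longer tuple of smaller rank. Yet every
one-element tuple has some colour. -/
theorem not_treeIndiscernible_of_certificate {L₁ : FirstOrder.Language.{u, u}} {M : Type u}
    [colourLanguage.{u}.Structure M] [L₁.Structure M] (ι : colourLanguage.{u} →ᴸ L₁)
    [ι.IsExpansionOn M] {ρ : ∀ _ : ℕ, ℕ → Ordinal.{u}} {kk : ∀ n : ℕ, ℕ → Fin (n + 1)}
    (hP : IsRankCertificate ρ kk (colourRelations M)) {a : (ℕ → Bool) → M}
    (hinj : Function.Injective a) : ¬ TreeIndiscernible L₁ a := by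
  intro ha
  have key : ∀ (γ : Ordinal.{u}) (n c : ℕ) (η : Fin (n + 1) → ℕ → Bool), Function.Injective η →
      ρ n c = γ → ¬ colourRelations M n c (a ∘ η) := by
    intro γ
    induction γ using WellFoundedLT.induction with
    | ind γ ih =>
      intro n c η hη hγ h
      let φ : L₁.Formula (Fin (n + 1)) :=
        (ι.onRelation (colourRel.{u} (n + 1) c)).formula fun i => Term.var i
      have hφ : ∀ x : Fin (n + 1) → M, φ.Realize x ↔ colourRelations M n c x := fun x =>
        FirstOrder.Language.Formula.realize_rel.trans
          (iff_of_eq (ι.map_onRelation (colourRel.{u} (n + 1) c) x))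
      obtain ⟨ν, hν, hiff⟩ := ha.exists_update φ η hη (kk n c)
      rw [hφ, hφ] at hiff
      have hs : (Fin.snoc (a ∘ η) (a ν) : Fin (n + 2) → M) =
          a ∘ (Fin.snoc η ν : Fin (n + 2) → ℕ → Bool) := by rw [Fin.comp_snoc]
      have hη' := snoc_injective hη hν
      obtain ⟨c', hc', hr⟩ := hP.descent n c (a ∘ η) (a ν) (by rw [hs]; exact hinj.comp hη')
        h (hiff.1 h)
      rw [hs] at hr
      exact ih _ (hγ ▸ hc') (n + 1) c' _ hη' rfl hr
  obtain ⟨c, hc⟩ := hP.total 0 (a ∘ fun _ => fun _ => false)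
  exact key _ 0 c _ (fun i j _ => Subsingleton.elim (α := Fin 1) i j) rfl hc

theorem TreeModelProperty.pr {lam : Cardinal.{u}} (h : TreeModelProperty lam) : Pr ω₁ lam := by
  by_contra hpr
  obtain ⟨M, rfl, hM⟩ := exists_hasRankCertificate_of_not_pr hpr
  obtain ⟨α, ρ, kk, ψ, R, hstr, -, -, hψ, hψM, hR⟩ := hM.exists_sentence
  obtain ⟨L₁, ι, T₁, M₁, _, _, a, -, -, hι, -, -, -, hψ₁, ha, -⟩ :=
    h colourLanguage colourLanguage_card R ψ
      ⟨M, hstr, hψM, by rw [hR, Cardinal.mk_univ]⟩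
  exact not_treeIndiscernible_of_certificate ι ((hψ M₁).1 hψ₁) ha.inj ha.indisc

/-- If `ν < μ`, then Pr fails at `ν`. The resulting certificate passes, as a sentence, to a model of
size continuum, and then to a subset of size `μ`, where Pr holds. -/
theorem le_of_continuumHanfBound {μ ν : Cardinal.{u}} (hμ : IsLeast {lam | Pr ω₁ lam} μ)
    (hc : μ < Cardinal.continuum) (hν : ContinuumHanfBound ν) : μ ≤ ν := by
  by_contra! hlt
  have hpr : ¬ Pr ω₁ ν := fun h => absurd (hμ.2 h) (not_le.2 hlt)
  obtain ⟨M, hMν, hM⟩ := exists_hasRankCertificate_of_not_pr hpr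
  obtain ⟨α, ρ, kk, ψ, R, hstr, hα, hρ, hψ, hψM, -⟩ := hM.exists_sentence
  obtain ⟨N, _, hψN, hN⟩ := hν colourLanguage colourLanguage_card ψ ⟨M, hstr, hψM, hMν.ge⟩
  have hcert : HasRankCertificate N := ⟨α, ρ, kk, _, hα, hρ, (hψ N).1 hψN⟩
  obtain ⟨s, hs⟩ := Cardinal.le_mk_iff_exists_set.1 (hN.symm ▸ hc.le : μ ≤ Cardinal.mk N)
  refine (hcert.of_injective ((↑) : s → N) Subtype.val_injective).not_pr ?_
  rw [hs]
  exact hμ.1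

end TreeContradiction

/-! ### Countable expansions with Skolem functions. -/

section SkolemExpansion

variable {M : Type u}

/-- The language whose symbols are functions in `F` and relations in `D`. -/
def semanticLanguage (F : ∀ n, Set ((Fin n → M) → M)) (D : ∀ n, Set (Set (Fin n → M))) :
    FirstOrder.Language.{u, u} :=
  ⟨fun n => F n, fun n => D n⟩

instance (F : ∀ n, Set ((Fin n → M) → M)) (D : ∀ n, Set (Set (Fin n → M))) :
    (semanticLanguage F D).Structure M where
  funMap := fun f x => f.1 x
  RelMap := fun R x => x ∈ R.1

theorem semanticLanguage_card {F : ∀ n, Set ((Fin n → M) → M)} {D : ∀ n, Set (Set (Fin n → M))}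
    (hF : ∀ n, (F n).Countable) (hD : ∀ n, (D n).Countable) :
    (semanticLanguage F D).card ≤ ℵ₀ := by
  have : ∀ n, Countable ((semanticLanguage F D).Functions n) := fun n => (hF n).to_subtype
  have : ∀ n, Countable ((semanticLanguage F D).Relations n) := fun n => (hD n).to_subtype
  rw [FirstOrder.Language.card, Cardinal.mk_le_aleph0_iff]
  unfold FirstOrder.Language.Symbols
  infer_instance

theorem sum_card_le_aleph0 {L L' : FirstOrder.Language.{u, u}} (h : L.card ≤ ℵ₀)
    (h' : L'.card ≤ ℵ₀) : (L.sum L').card ≤ ℵ₀ := by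
  rw [FirstOrder.Language.card_sum]
  exact Cardinal.add_le_aleph0.2 ⟨by simpa using h, by simpa using h'⟩

theorem countable_definable {L : FirstOrder.Language.{u, u}} (hL : L.card ≤ ℵ₀) [L.Structure M]
    (α : Type) [Countable α] : {S : Set (α → M) | (∅ : Set M).Definable L S}.Countable := by
  have := countable_formula hL α
  refine (Set.countable_range fun φ : L.Formula α => Set.ofPred (φ.Realize (M := M))).mono ?_
  rintro S hS
  obtain ⟨φ, hφ⟩ := Set.empty_definable_iff.1 hS
  exact ⟨φ, hφ.symm⟩

theorem countable_definableFun {L : FirstOrder.Language.{u, u}} (hL : L.card ≤ ℵ₀) [L.Structure M]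
    (n : ℕ) : {f : (Fin n → M) → M | (∅ : Set M).DefinableFun L f}.Countable := by
  refine ((countable_definable hL (Option (Fin n)) (M := M)).preimage_of_injOn
    (f := Function.tupleGraph) ?_).mono fun f hf => hf
  intro f _ g _ h
  ext x
  have : (fun o : Option (Fin n) => o.elim (f x) x) ∈ Function.tupleGraph f := rfl
  rw [h] at this
  exact this.symm

/-- Formulas in definable functions and relations define definable sets. -/
theorem definable_of_definable_symbols {L₀ L₁ : FirstOrder.Language.{u, u}} [L₀.Structure M]
    [L₁.Structure M]
    (hf : ∀ (n : ℕ) (f : L₁.Functions n), (∅ : Set M).DefinableFun L₀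
      (FirstOrder.Language.Structure.funMap f : (Fin n → M) → M))
    (hr : ∀ (n : ℕ) (R : L₁.Relations n), (∅ : Set M).Definable L₀
      {x : Fin n → M | FirstOrder.Language.Structure.RelMap R x})
    {α : Type} {n : ℕ} (φ : L₁.BoundedFormula α n) :
    (∅ : Set M).Definable L₀ {v : α ⊕ Fin n → M | φ.Realize (v ∘ Sum.inl) (v ∘ Sum.inr)} := by
  have ht : ∀ {β : Type} (t : L₁.Term β), (∅ : Set M).DefinableFun L₀ (t.realize (M := M)) := by
    intro β t
    induction t with
    | var i => exact L₀.definableFun_var i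
    | func f ts ih => exact Set.DefinableFun.comp (g := fun v i => (ts i).realize v) ih (hf _ f)
  induction φ with
  | falsum => simp [FirstOrder.Language.BoundedFormula.Realize]
  | equal t₁ t₂ =>
    simpa [FirstOrder.Language.BoundedFormula.Realize] using! (ht t₁).ofPred_eq (ht t₂)
  | rel R ts =>
    have := (hr _ R).preimage_map (F := fun v i => (ts i).realize v) fun i => ht (ts i)
    simpa [FirstOrder.Language.BoundedFormula.Realize] using! this
  | imp φ ψ ih₁ ih₂ =>
    convert! ih₁.compl.union ih₂ using 1
    ext v
    simp [FirstOrder.Language.BoundedFormula.Realize, imp_iff_not_or]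
  | @all n φ ih =>
    have h := (ih.preimage_comp (β := (α ⊕ Fin n) ⊕ Unit)
      (Sum.elim (fun a => Sum.inl (Sum.inl a)) (Fin.snoc (fun i => Sum.inl (Sum.inr i))
        (Sum.inr ())))).forall_of_finite
    convert! h using 1
    ext v
    simp only [FirstOrder.Language.BoundedFormula.Realize, Set.mem_ofPred_eq, Set.mem_preimage]
    have key : ∀ y : M, (Sum.elim v (fun _ : Unit => y) ∘
        Sum.elim (fun a => Sum.inl (Sum.inl a)) (Fin.snoc (fun i => Sum.inl (Sum.inr i))
        (Sum.inr ()) : Fin (n + 1) → (α ⊕ Fin n) ⊕ Unit)) ∘ Sum.inr =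
        (Fin.snoc (v ∘ Sum.inr) y : Fin (n + 1) → M) := by
      intro y
      ext i
      refine Fin.lastCases ?_ (fun i => ?_) i <;> simp
    constructor
    · intro h u
      have := h (u ())
      rw [← key] at this
      exact this
    · intro h y
      have := h fun _ => y
      rw [key] at this
      exact this

/-- The function picks the least witness in a definable well-order. `S'` admits every `y` when there
is no witness, so that the minimum exists for all `x`. -/
theorem exists_definable_selection [Nonempty M] {L : FirstOrder.Language.{u, u}} [L.Structure M]
    (hlt : (∅ : Set M).Definable L {x : Fin 2 → M | WellOrderingRel (x 0) (x 1)})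
    {n : ℕ} {S : Set (Fin (n + 1) → M)} (hS : (∅ : Set M).Definable L S) :
    ∃ f : (Fin n → M) → M, (∅ : Set M).DefinableFun L f ∧
      ∀ x, (∃ y, (Fin.snoc x y : Fin (n + 1) → M) ∈ S) →
        (Fin.snoc x (f x) : Fin (n + 1) → M) ∈ S := by
  let e : Fin (n + 1) → Option (Fin n) := Fin.snoc some none
  have he : ∀ (x : Option (Fin n) → M), x ∘ e =
      (Fin.snoc (x ∘ some) (x none) : Fin (n + 1) → M) := fun x => by
    rw [Fin.comp_snoc]
  let S' : Set (Option (Fin n) → M) := {w | w ∘ e ∈ S ∨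
    ¬ ∃ y, (Fin.snoc (w ∘ some) y : Fin (n + 1) → M) ∈ S}
  have hS' : (∅ : Set M).Definable L S' := by
    have h1 := hS.preimage_comp e
    have h2 := (hS.preimage_comp (β := Option (Fin n) ⊕ Unit)
      (Fin.snoc (fun i => Sum.inl (some i)) (Sum.inr ()))).exists_of_finite.compl
    convert! h1.union h2 using 1
    ext w
    have : ∀ u : Unit → M, Sum.elim w u ∘ (Fin.snoc (fun i => Sum.inl (some i)) (Sum.inr ()) :
        Fin (n + 1) → Option (Fin n) ⊕ Unit) =
        (Fin.snoc (w ∘ some) (u ()) : Fin (n + 1) → M) := fun u => by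
      rw [Fin.comp_snoc]; rfl
    simp only [S', Set.mem_ofPred_eq, Set.mem_union, Set.mem_preimage, Set.mem_compl_iff, this]
    refine or_congr Iff.rfl (not_congr ⟨fun ⟨y, hy⟩ => ⟨fun _ => y, hy⟩, fun ⟨u, hu⟩ => ⟨_, hu⟩⟩)
  let T : (Fin n → M) → Set M := fun x => {y | (fun o => o.elim y x : Option (Fin n) → M) ∈ S'}
  have hT : ∀ x y, y ∈ T x ↔ ((Fin.snoc x y : Fin (n + 1) → M) ∈ S ∨
      ¬ ∃ y, (Fin.snoc x y : Fin (n + 1) → M) ∈ S) := by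
    intro x y
    simp only [T, S', Set.mem_ofPred_eq, he]
    rfl
  have hTne : ∀ x, (T x).Nonempty := by
    intro x
    by_cases h : ∃ y, (Fin.snoc x y : Fin (n + 1) → M) ∈ S
    · obtain ⟨y, hy⟩ := h
      exact ⟨y, (hT x y).2 (Or.inl hy)⟩
    · exact ⟨Classical.arbitrary M, (hT x _).2 (Or.inr h)⟩
  have hwf : WellFounded (WellOrderingRel : M → M → Prop) := IsWellFounded.wf
  refine ⟨fun x => hwf.min (T x) (hTne x), ?_, fun x hx => ?_⟩
  · have h1 := ((hS'.preimage_comp (β := Option (Fin n) ⊕ Unit)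
      (fun o => o.elim (Sum.inr ()) fun i => Sum.inl (some i))).compl.union
      (hlt.preimage_comp (β := Option (Fin n) ⊕ Unit)
      ![Sum.inr (), Sum.inl none]).compl).forall_of_finite
    have h2 := hS'.inter h1
    unfold Set.DefinableFun
    convert! h2 using 1
    ext w
    have hw : ∀ y, y ∈ T (w ∘ some) ↔ (Sum.elim w (fun _ : Unit => y)) ∘
        (fun o : Option (Fin n) => o.elim (Sum.inr ()) fun i => Sum.inl (some i)) ∈ S' := by
      intro y
      refine iff_of_eq (congrArg (· ∈ S') ?_)
      ext o
      cases o <;> rfl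
    have hw0 : w none ∈ T (w ∘ some) ↔ w ∈ S' := by
      refine iff_of_eq (congrArg (· ∈ S') ?_)
      ext o
      cases o <;> rfl
    rw [Set.mem_inter_iff, ← hw0]
    change hwf.min (T (w ∘ some)) (hTne _) = w none ↔ _
    constructor
    · intro h
      refine ⟨h ▸ hwf.min_mem _ _, fun y => ?_⟩
      by_cases hy : y () ∈ T (w ∘ some)
      · refine Or.inr fun hlt => ?_
        have : WellOrderingRel (y ()) (w none) := hlt
        rw [← h] at this
        exact hwf.not_lt_min _ hy this
      · exact Or.inl fun h => hy ((hw _).2 h)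
    · rintro ⟨h1, h2⟩
      rcases trichotomous_of WellOrderingRel (hwf.min (T (w ∘ some)) (hTne _)) (w none)
        with h | h | h
      · rcases h2 fun _ => hwf.min (T (w ∘ some)) (hTne _) with h3 | h3
        · exact absurd ((hw _).1 (hwf.min_mem _ _)) h3
        · exact absurd h h3
      · exact h
      · exact absurd h (hwf.not_lt_min _ h1)
  · exact ((hT x _).1 (hwf.min_mem _ (hTne x))).resolve_right (not_not.2 hx)

/-- Every countable vocabulary expands, on a given model, to a countable one with Skolem functions
and with names for countably many given relations. -/
theorem exists_skolem_expansion {L : FirstOrder.Language.{u, u}} (hL : L.card ≤ ℵ₀)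
    [L.Structure M] [Nonempty M] (D : ∀ n, Set (Set (Fin n → M))) (hD : ∀ n, (D n).Countable) :
    ∃ (L₁ : FirstOrder.Language.{u, u}) (ι : L →ᴸ L₁) (_ : L₁.Structure M),
      L₁.card ≤ ℵ₀ ∧ ι.Injective ∧ ι.IsExpansionOn M ∧
      (∀ (n : ℕ) (φ : L₁.Formula (Fin (n + 1))), ∃ f : L₁.Functions n, ∀ x : Fin n → M,
        (∃ y, φ.Realize (Fin.snoc x y : Fin (n + 1) → M)) →
        φ.Realize (Fin.snoc x (FirstOrder.Language.Structure.funMap f x) : Fin (n + 1) → M)) ∧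
      ∀ (n : ℕ), ∀ S ∈ D n, ∃ R : L₁.Relations n, ∀ x : Fin n → M,
        FirstOrder.Language.Structure.RelMap R x ↔ x ∈ S := by
  let D' : ∀ n, Set (Set (Fin n → M)) := fun n =>
    D n ∪ Set.range fun p : Fin n × Fin n => {x | WellOrderingRel (x p.1) (x p.2)}
  let L₀ := L.sum (semanticLanguage (fun _ => ∅) D')
  have hL₀ : L₀.card ≤ ℵ₀ := sum_card_le_aleph0 hL
    (semanticLanguage_card (fun _ => Set.countable_empty)
      fun n => (hD n).union (Set.countable_range _))
  let F₁ : ∀ n, Set ((Fin n → M) → M) := fun n => {f | (∅ : Set M).DefinableFun L₀ f}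
  let D₁ : ∀ n, Set (Set (Fin n → M)) := fun n => {S | (∅ : Set M).Definable L₀ S}
  have hD₀ : ∀ n, ∀ S ∈ D' n, S ∈ D₁ n := by
    intro n S hS
    let R : L₀.Relations n := Sum.inr ⟨S, hS⟩
    refine Set.empty_definable_iff.2 ⟨R.formula fun i => Term.var i, ?_⟩
    ext x
    exact Iff.symm (FirstOrder.Language.Formula.realize_rel (R := R))
  -- All `L₀`-definable functions and relations become symbols at once. No new definable sets arise,
  -- so the least-witness functions for `L₁`-formulas are already symbols and nothing has to be
  -- iterated.
  let L₁ := L.sum (semanticLanguage F₁ D₁)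
  have hlt : (∅ : Set M).Definable L₀ {x : Fin 2 → M | WellOrderingRel (x 0) (x 1)} :=
    hD₀ 2 _ (Or.inr ⟨(0, 1), rfl⟩)
  have hdef : ∀ {n : ℕ} (φ : L₁.Formula (Fin n)),
      (∅ : Set M).Definable L₀ {x : Fin n → M | φ.Realize x} := by
    intro n φ
    have h := definable_of_definable_symbols (M := M) (L₀ := L₀) (L₁ := L₁) ?_ ?_ φ
    · have h2 := h.preimage_comp (β := Fin n) (Sum.elim id Fin.elim0)
      convert! h2 using 1
      ext x
      refine iff_of_eq (congrArg (FirstOrder.Language.BoundedFormula.Realize φ x) ?_)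
      exact Subsingleton.elim _ _
    · rintro n (f | f)
      · exact Set.DefinableFun.fun_symbol (L := L₀) (Sum.inl f)
      · exact f.2
    · rintro n (R | R)
      · refine Set.empty_definable_iff.2 ⟨Relations.formula (L := L₀) (Sum.inl R)
          fun i => Term.var i, ?_⟩
        ext x
        exact Iff.symm (FirstOrder.Language.Formula.realize_rel (L := L₀) (R := Sum.inl R))
      · exact R.2
  refine ⟨L₁, LHom.sumInl, inferInstance, sum_card_le_aleph0 hL (semanticLanguage_card
    (fun n => countable_definableFun hL₀ n) (fun n => countable_definable hL₀ _)),
    LHom.sumInl_injective, inferInstance, ?_, ?_⟩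
  · intro n φ
    obtain ⟨f, hf, hsel⟩ := exists_definable_selection hlt (hdef φ)
    exact ⟨Sum.inr ⟨f, hf⟩, hsel⟩
  · intro n S hS
    exact ⟨Sum.inr ⟨S, hD₀ n S (Or.inl hS)⟩, fun x => Iff.rfl⟩

end SkolemExpansion

/-! ### Large sets of tuples and the tree approximation. -/

section LargeSets

/-- The relational language with a symbol for every formula of `L`. -/
def formulaLanguage (L : FirstOrder.Language.{u, u}) : FirstOrder.Language.{u, u} :=
  ⟨fun _ => PEmpty, fun n => L.Formula (Fin n)⟩

theorem formulaLanguage_card {L : FirstOrder.Language.{u, u}} (hL : L.card ≤ ℵ₀) :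
    (formulaLanguage L).card ≤ ℵ₀ := by
  have h1 : ∀ n, Countable (L.Formula (Fin n)) := fun n => countable_formula hL _
  rw [FirstOrder.Language.card, Cardinal.mk_le_aleph0_iff]
  unfold FirstOrder.Language.Symbols formulaLanguage
  infer_instance

variable {L : FirstOrder.Language.{u, u}} {M : Type u} [L.Structure M]

instance (A : Set M) : (formulaLanguage L).Structure A where
  funMap := fun f => f.elim
  RelMap := fun {n} (φ : L.Formula (Fin n)) x => φ.Realize fun i => (x i : M)

theorem definable_injective (n : ℕ) :
    (∅ : Set M).Definable L {x : Fin n → M | Function.Injective x} := by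
  have h : ∀ i j : Fin n, (∅ : Set M).Definable L {x : Fin n → M | x i = x j → i = j} := by
    intro i j
    by_cases hij : i = j
    · convert! Set.definable_univ using 1
      ext x
      simp [hij]
    · convert! ((Set.DefinableFun.proj L (i := i)).ofPred_eq
        (Set.DefinableFun.proj L (i := j))).compl using 1
      ext x
      simp [hij]
  have := Set.definable_iInter_of_finite fun i => Set.definable_iInter_of_finite fun j => h i j
  convert! this using 1
  ext x
  simp [Function.Injective]

/-- A definable condition on points of `t` is atomic in `formulaLanguage L`, so a split can be
required to preserve it. Adding injectivity to the condition puts the new point outside `t`. A split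
moves a point of `t`, hence all positions with the value `b j₀` together. -/
theorem RkSucc.exists_split {A : Set M} {P : Finset A → Prop} {t : Finset A}
    (ht : RkSucc (formulaLanguage L) P t) {J : Type} [Finite J] {b : J → A} (hb : ∀ j, b j ∈ t)
    (j₀ : J) {W : Set (J → M)} (hW : (∅ : Set M).Definable L W)
    (hbW : (fun j => (b j : M)) ∈ W) :
    ∃ (t' : Finset A) (y : A), P t' ∧ t ⊆ t' ∧ y ∈ t' ∧ y ∉ t ∧
      ∀ c : J → A, (∀ j, b j = b j₀ → c j = y) → (∀ j, b j ≠ b j₀ → c j = b j) →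
        (fun j => (c j : M)) ∈ W := by
  classical
  obtain ⟨n, e, he, het⟩ := exists_fin_enum ht.1
  have hg : ∀ j, ∃ i, e i = b j := fun j => (het _).1 (hb j)
  choose g hg using hg
  obtain ⟨φ, hφ⟩ := Set.empty_definable_iff.1
    ((definable_injective (L := L) (M := M) (n + 1)).inter (hW.preimage_comp g))
  have hφ' : ∀ x : Fin (n + 1) → M, φ.Realize x ↔ Function.Injective x ∧ x ∘ g ∈ W := fun x =>
    iff_of_eq (congrArg (x ∈ ·) hφ.symm)
  let R : (formulaLanguage L).Relations (n + 1) := φ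
  have hR : ∀ x : Fin (n + 1) → A, (R.formula fun i => Term.var i).Realize x ↔
      Function.Injective x ∧ (fun j => (x (g j) : M)) ∈ W := fun x => by
    refine FirstOrder.Language.Formula.realize_rel.trans ((hφ' fun i => (x i : M)).trans ?_)
    exact and_congr (Subtype.val_injective.of_comp_iff x) Iff.rfl
  obtain ⟨a', ha1, ha2, ha3, ha4, ha5⟩ := ht.2 (n + 1) e he
    (by ext z; simp only [Finset.mem_image, Finset.mem_univ, true_and, het, Set.mem_range])
    (g j₀) (R.formula fun i => Term.var i)
    (FirstOrder.Language.BoundedFormula.IsAtomic.rel _ _).isQF ((hR e).2 ⟨he, by simpa [hg]⟩)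
  have hx0 : a' 0 = e := (funext ha5).symm
  have h1 := (hR _).1 (ha2 1)
  refine ⟨_, a' 1 (g j₀), ha1, ?_, ?_, ?_, ?_⟩
  · intro z hz
    obtain ⟨i, rfl⟩ := (het z).1 hz
    simp only [Finset.mem_image]
    exact ⟨(0, i), Finset.mem_univ _, by rw [hx0]⟩
  · simp only [Finset.mem_image]
    exact ⟨(1, g j₀), Finset.mem_univ _, rfl⟩
  · intro hy
    obtain ⟨m, hm⟩ := (het _).1 hy
    by_cases hmk : m = g j₀
    · exact ha3 (by rw [← hm, hmk, hx0])
    · exact hmk (h1.1 (by rw [← ha4 m hmk, hx0, hm]))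
  · intro c hc1 hc2
    convert h1.2 using 1
    ext j
    congr 1
    by_cases hj : b j = b j₀
    · rw [hc1 j hj]
      congr 1
      exact he (by rw [hg, hg, hj])
    · rw [hc2 j hj, ← ha4, hx0, hg]
      intro h
      exact hj (by rw [← hg, ← hg, h])

variable (L) in
/-- The set `S` of tuples contains injective tuples from finite subsets of `A` of arbitrarily large
countable rank. -/
def IsLargeIn (A : Set M) {I : Type} (S : Set (I → M)) : Prop :=
  ∀ α < (ω₁ : Ordinal.{u}), ∃ β > α, ∃ t : Finset A, RkGE (formulaLanguage L) (ℵ_ 1) β t ∧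
    ∃ b : I → A, Function.Injective b ∧ (∀ i, b i ∈ t) ∧ (fun i => (b i : M)) ∈ S

/-- If each piece failed past some `α i < ω₁`, a tuple of `S` from a set of rank beyond the
countable supremum would lie in no piece. -/
theorem IsLargeIn.exists_inter {A : Set M} {I : Type} {S : Set (I → M)} (h : IsLargeIn L A S)
    (D : ℕ → Set (I → M)) (hD : ∀ x, ∃ i, x ∈ D i) : ∃ i, IsLargeIn L A (S ∩ D i) := by
  by_contra! hc
  simp only [IsLargeIn, not_forall] at hc
  choose α hα hno using hc
  obtain ⟨β, hβ, t, ht, b, hb, hbt, hbS⟩ := h (⨆ i, α i) (Ordinal.iSup_lt_omega_one hα)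
  obtain ⟨i, hi⟩ := hD fun i => (b i : M)
  exact hno i ⟨β, (Ordinal.le_iSup α i).trans_lt hβ, t, ht, b, hb, hbt, hbS, hi⟩

theorem IsLargeIn.exists_decided {A : Set M} {I : Type} {S : Set (I → M)}
    (h : IsLargeIn L A S) (hS : (∅ : Set M).Definable L S) {Q : Type*} [Finite Q]
    (D : Q → ℕ → Set (I → M)) (hD : ∀ q i, (∅ : Set M).Definable L (D q i))
    (hcov : ∀ q x, ∃ i, x ∈ D q i) :
    ∃ S' ⊆ S, IsLargeIn L A S' ∧ (∅ : Set M).Definable L S' ∧ ∀ q, ∃ i, S' ⊆ D q i := by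
  classical
  have := Fintype.ofFinite Q
  suffices ∀ F : Finset Q, ∃ S' ⊆ S, IsLargeIn L A S' ∧ (∅ : Set M).Definable L S' ∧
      ∀ q ∈ F, ∃ i, S' ⊆ D q i by
    obtain ⟨S', h1, h2, h3, h4⟩ := this Finset.univ
    exact ⟨S', h1, h2, h3, fun q => h4 q (Finset.mem_univ _)⟩
  intro F
  induction F using Finset.induction_on with
  | empty => exact ⟨S, subset_rfl, h, hS, by simp⟩
  | insert q F _ ih =>
    obtain ⟨S', h1, h2, h3, h4⟩ := ih
    obtain ⟨i, hi⟩ := h2.exists_inter (D q) (hcov q)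
    refine ⟨S' ∩ D q i, Set.inter_subset_left.trans h1, hi, h3.inter (hD q i), ?_⟩
    intro q' hq'
    rcases Finset.mem_insert.1 hq' with rfl | hq'
    · exact ⟨i, Set.inter_subset_right⟩
    · obtain ⟨i', hi'⟩ := h4 q' hq'
      exact ⟨i', Set.inter_subset_left.trans hi'⟩

/-- Large sets remain large when every coordinate is doubled. -/
theorem IsLargeIn.exists_double {A : Set M} {I : Type} [Finite I] {S : Set (I → M)}
    (h : IsLargeIn L A S) (hS : (∅ : Set M).Definable L S) :
    IsLargeIn L A {c : I × Bool → M | ∀ σ : I → Bool, (fun i => c (i, σ i)) ∈ S} := by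
  classical
  have := Fintype.ofFinite I
  suffices ∀ K : Finset I, ∀ α < (ω₁ : Ordinal.{u}), ∃ β > α, ∃ t : Finset A,
      RkGE (formulaLanguage L) (ℵ_ 1) β t ∧ ∃ b : I × Bool → A,
        Set.InjOn b {p | p.2 = false ∨ p.1 ∈ K} ∧ (∀ p, b p ∈ t) ∧
        ∀ σ : I → Bool, (∀ i, σ i = true → i ∈ K) → (fun i => (b (i, σ i) : M)) ∈ S by
    intro α hα
    obtain ⟨β, hβ, t, ht, b, h1, h2, h3⟩ := this Finset.univ α hα
    refine ⟨β, hβ, t, ht, b, fun p q hpq => h1 (by simp) (by simp) hpq, h2, fun σ => ?_⟩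
    exact h3 σ fun i _ => Finset.mem_univ i
  intro K
  induction K using Finset.induction_on with
  | empty =>
    intro α hα
    obtain ⟨β, hβ, t, ht, b, h1, h2, h3⟩ := h α hα
    refine ⟨β, hβ, t, ht, fun p => b p.1, ?_, fun p => h2 _, fun σ _ => h3⟩
    rintro ⟨i, p⟩ hp ⟨j, q⟩ hq hpq
    simp only [Finset.notMem_empty, or_false, Set.mem_ofPred_eq] at hp hq
    exact Prod.ext (h1 hpq) (hp.trans hq.symm)
  | insert k K hk ih =>
    intro α hα
    -- One doubling spends one rank, so the induction hypothesis is used at `α + 1`.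
    have hα' : α + 1 < ω₁ := (Cardinal.isSuccLimit_omega 1).add_one_lt hα
    obtain ⟨β, hβ, t, ht, b, h1, h2, h3⟩ := ih _ hα'
    obtain ⟨γ, hγ, hs⟩ := ht.exists_rkSucc _ hβ
    have hW : (∅ : Set M).Definable L
        (⋂ σ : {σ : I → Bool // ∀ i, σ i = true → i ∈ K},
          (fun c : I × Bool → M => c ∘ fun i => (i, σ.1 i)) ⁻¹' S) :=
      Set.definable_iInter_of_finite fun σ => hS.preimage_comp _
    obtain ⟨t', y, hP, htt', hy, hyt, hc⟩ := hs.exists_split h2 (k, false) hW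
      (Set.mem_iInter.2 fun σ => h3 σ.1 σ.2)
    refine ⟨γ, (Order.lt_add_one_iff.2 le_rfl).trans_le hγ, t', hP,
      Function.update b (k, true) y, ?_, ?_, ?_⟩
    · intro p hp q hq hpq
      have hold : ∀ p : I × Bool, p ∈ {p : I × Bool | p.2 = false ∨ p.1 ∈ insert k K} →
          p ≠ (k, true) → p ∈ {p : I × Bool | p.2 = false ∨ p.1 ∈ K} := by
        rintro ⟨i, r⟩ hp hne
        cases r with
        | false => exact Or.inl rfl
        | true =>
          refine Or.inr ?_
          rcases hp with hp | hp
          · simp at hp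
          · exact (Finset.mem_insert.1 hp).resolve_left fun h => hne (by rw [show i = k from h])
      by_cases hpk : p = (k, true) <;> by_cases hqk : q = (k, true)
      · rw [hpk, hqk]
      · rw [hpk, Function.update_self, Function.update_of_ne hqk] at hpq
        exact absurd (hpq ▸ h2 q) hyt
      · rw [hqk, Function.update_self, Function.update_of_ne hpk] at hpq
        exact absurd (hpq ▸ h2 p) hyt
      · rw [Function.update_of_ne hpk, Function.update_of_ne hqk] at hpq
        exact h1 (hold p hp hpk) (hold q hq hqk) hpq
    · intro p
      by_cases hpk : p = (k, true)
      · rw [hpk, Function.update_self]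
        exact hy
      · rw [Function.update_of_ne hpk]
        exact htt' (h2 p)
    · intro σ hσ
      cases hσk : σ k with
      | false =>
        have : ∀ i, Function.update b (k, true) y (i, σ i) = b (i, σ i) := by
          intro i
          refine Function.update_of_ne ?_ _ _
          rintro h
          simp only [Prod.mk.injEq] at h
          rw [← h.1, h.2] at hσk
          exact absurd hσk (by simp)
        simp only [this]
        refine h3 σ fun i hi => (Finset.mem_insert.1 (hσ i hi)).resolve_left ?_
        rintro rfl
        simp [hσk] at hi
      | true =>
        have hσ' : ∀ i, Function.update σ k false i = true → i ∈ K := by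
          intro i hi
          by_cases hik : i = k
          · subst hik
            simp at hi
          · rw [Function.update_of_ne hik] at hi
            exact (Finset.mem_insert.1 (hσ i hi)).resolve_left hik
        -- A section through `(k, true)` is an old section through `(k, false)` with that one value
        -- replaced by `y`.
        have := Set.mem_iInter.1 (hc (fun p => if b p = b (k, false) then y else b p)
          (fun p hp => if_pos hp) fun p hp => if_neg hp) ⟨Function.update σ k false, hσ'⟩
        rw [Set.mem_preimage] at this
        convert this using 1
        ext i
        by_cases hik : i = k
        · subst hik
          simp [hσk]
        · have hne : b (i, σ i) ≠ b (k, false) := by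
            intro h
            have := h1 ?_ (Or.inl rfl) h
            · simp only [Prod.mk.injEq] at this
              exact hik this.1
            · cases hσi : σ i with
              | false => exact Or.inl rfl
              | true => exact Or.inr ((Finset.mem_insert.1 (hσ i hσi)).resolve_left hik)
          simp [hne, hik]

/-- The tuples indexed by level `l + 1` of the binary tree all of whose restrictions along
sections to level `l` are in `S`. -/
def splitSet {M : Type u} {l : ℕ} (S : Set ((Fin l → Bool) → M)) : Set ((Fin (l + 1) → Bool) → M) :=
  {c | ∀ σ : (Fin l → Bool) → Bool,
    (fun z => c (Fin.snoc z (σ z) : Fin (l + 1) → Bool)) ∈ S}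

theorem IsLargeIn.splitSet {A : Set M} {l : ℕ} {S : Set ((Fin l → Bool) → M)}
    (h : IsLargeIn L A S) (hS : (∅ : Set M).Definable L S) : IsLargeIn L A (splitSet S) := by
  intro α hα
  obtain ⟨β, hβ, t, ht, b, h1, h2, h3⟩ := h.exists_double hS α hα
  refine ⟨β, hβ, t, ht, fun z => b (Fin.init z, z (Fin.last l)), ?_, fun z => h2 _, fun σ => ?_⟩
  · intro z z' hz
    have := h1 hz
    simp only [Prod.mk.injEq] at this
    rw [← Fin.snoc_init_self z, ← Fin.snoc_init_self z', this.1, this.2]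
  · simpa using h3 σ

theorem definable_splitSet {l : ℕ} {S : Set ((Fin l → Bool) → M)}
    (hS : (∅ : Set M).Definable L S) : (∅ : Set M).Definable L (splitSet S) := by
  have := Set.definable_iInter_of_finite fun σ : (Fin l → Bool) → Bool =>
    hS.preimage_comp fun z => (Fin.snoc z (σ z) : Fin (l + 1) → Bool)
  convert! this using 1
  ext c
  simp only [Set.mem_iInter]
  rfl

theorem isLargeIn_univ (hL : L.card ≤ ℵ₀) {A : Set M} (hA : Pr ω₁ (Cardinal.mk A))
    {I : Type} [Unique I] : IsLargeIn L A (Set.univ : Set (I → M)) := by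
  intro α hα
  obtain ⟨β, hβ, t, ⟨y, hy⟩, ht⟩ := exists_rkGE_of_omega_one_le _
    (hA (formulaLanguage L) (formulaLanguage_card hL) A rfl) hα
  exact ⟨β, hβ, t, ht, fun _ => y, Function.injective_of_subsingleton _, fun _ => hy, trivial⟩

/-- A decreasing system of sets of tuples indexed by the levels of the binary tree, deciding
given countable covers. -/
theorem exists_tree_approximation (hL : L.card ≤ ℵ₀) {A : Set M} (hA : Pr ω₁ (Cardinal.mk A))
    {T : Type*} (enc : T → ℕ) (henc : Function.Injective enc) (m : T → ℕ)
    (χ : ∀ τ, ℕ → L.Formula (Fin (m τ)))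
    (hχ : ∀ (τ : T) (x : Fin (m τ) → M), ∃ i, (χ τ i).Realize x) :
    ∃ S : ∀ l, Set ((Fin l → Bool) → M),
      (∀ l, ∃ b ∈ S l, Function.Injective b ∧ ∀ z, b z ∈ A) ∧
      (∀ l, S (l + 1) ⊆ splitSet (S l)) ∧
      ∀ l τ, enc τ ≤ l → ∀ s : Fin (m τ) → Fin (l + 1) → Bool, ∃ i, ∀ b ∈ S (l + 1),
        (χ τ i).Realize (b ∘ s) := by
  have step : ∀ (l : ℕ) (S : {S : Set ((Fin l → Bool) → M) //
      IsLargeIn L A S ∧ (∅ : Set M).Definable L S}),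
      ∃ S' : {S : Set ((Fin (l + 1) → Bool) → M) //
        IsLargeIn L A S ∧ (∅ : Set M).Definable L S}, S'.1 ⊆ splitSet S.1 ∧
        ∀ τ, enc τ ≤ l → ∀ s : Fin (m τ) → Fin (l + 1) → Bool, ∃ i, ∀ b ∈ S'.1,
          (χ τ i).Realize (b ∘ s) := by
    rintro l ⟨S, hS, hdef⟩
    -- Only covers with code at most `l` are treated at this level, along finitely many choices of
    -- nodes, so finitely many decisions suffice.
    have : Finite {τ : T // enc τ ≤ l} := Finite.of_injective
      (fun τ => (⟨enc τ.1, Nat.lt_succ_of_le τ.2⟩ : Fin (l + 1)))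
      fun τ τ' h => Subtype.ext (henc (by simpa using h))
    obtain ⟨S', h1, h2, h3, h4⟩ := (hS.splitSet hdef).exists_decided (definable_splitSet hdef)
      (Q := Σ τ : {τ : T // enc τ ≤ l}, Fin (m τ.1) → Fin (l + 1) → Bool)
      (fun q i => {b | (χ q.1.1 i).Realize (b ∘ q.2)})
      (fun q i => Set.Definable.preimage_comp (s := {x | (χ q.1.1 i).Realize x}) q.2
        (Set.empty_definable_iff.2 ⟨χ q.1.1 i, rfl⟩))
      (fun q x => hχ q.1.1 _)
    exact ⟨⟨S', h2, h3⟩, h1, fun τ hτ s => h4 ⟨⟨τ, hτ⟩, s⟩⟩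
  choose next hnext using step
  let S : ∀ l, {S : Set ((Fin l → Bool) → M) // IsLargeIn L A S ∧ (∅ : Set M).Definable L S} :=
    fun l => Nat.rec ⟨Set.univ, isLargeIn_univ hL hA, Set.definable_univ⟩ (fun l S => next l S) l
  refine ⟨fun l => (S l).1, fun l => ?_, fun l => (hnext l (S l)).1, fun l => (hnext l (S l)).2⟩
  obtain ⟨β, hβ, t, ht, b, h1, h2, h3⟩ := (S l).2.1 0 (Ordinal.omega_pos 1)
  exact ⟨_, h3, Subtype.val_injective.comp h1, fun z => (b z).2⟩

end LargeSets

/-! ### Skolem symbols in models of the complete theory. -/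

section SkolemTransfer

variable {L : FirstOrder.Language.{u, u}} {M : Type u} [L.Structure M]

theorem realize_of_model_completeTheory {n : ℕ} {θ : L.Formula (Fin n)}
    (h : ∀ x : Fin n → M, θ.Realize x) {N : Type u} [L.Structure N]
    (hN : N ⊨ L.completeTheory M) (x : Fin n → N) : θ.Realize x := by
  let σ : L.Sentence :=
    FirstOrder.Language.Formula.iAlls (α := Empty) (Fin n) (θ.relabel Sum.inr)
  have hσ : ∀ {K : Type u} [L.Structure K], K ⊨ σ ↔ ∀ x : Fin n → K, θ.Realize x := by
    intro K _
    refine (FirstOrder.Language.Formula.realize_iAlls (v := default)).trans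
      (forall_congr' fun x => ?_)
    rw [FirstOrder.Language.Formula.realize_relabel]
    rfl
  have hmem : σ ∈ L.completeTheory M := mem_completeTheory.2 (hσ.2 h)
  exact hσ.1 (Theory.realize_sentence_of_mem _ hmem) x

/-- `L` has function symbols interpreted in `M` by Skolem functions. -/
def HasSkolemSymbols (L : FirstOrder.Language.{u, u}) (M : Type u) [L.Structure M] : Prop :=
  ∀ (n : ℕ) (φ : L.Formula (Fin (n + 1))), ∃ f : L.Functions n, ∀ x : Fin n → M,
    (∃ y, φ.Realize (Fin.snoc x y : Fin (n + 1) → M)) →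
    φ.Realize (Fin.snoc x (FirstOrder.Language.Structure.funMap f x) : Fin (n + 1) → M)

theorem HasSkolemSymbols.exists_symbol (h : HasSkolemSymbols L M) {n : ℕ}
    (φ : L.Formula (Fin (n + 1))) : ∃ f : L.Functions n, ∀ (N : Type u) [L.Structure N],
      N ⊨ L.completeTheory M → ∀ x : Fin n → N,
      (∃ y, φ.Realize (Fin.snoc x y : Fin (n + 1) → N)) →
      φ.Realize (Fin.snoc x (FirstOrder.Language.Structure.funMap f x) : Fin (n + 1) → N) := by
  obtain ⟨f, hf⟩ := h n φ
  let tf : Fin (n + 1) → L.Term (Fin (n + 1)) :=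
    Fin.snoc (fun i => Term.var i.castSucc) (Term.func f fun i => Term.var i.castSucc)
  let θ : L.Formula (Fin (n + 1)) := φ.imp (FirstOrder.Language.BoundedFormula.subst φ tf)
  have htf : ∀ {K : Type u} [L.Structure K] (x : Fin n → K) (y : K),
      (fun i => (tf i).realize (Fin.snoc x y : Fin (n + 1) → K)) =
      (Fin.snoc x (FirstOrder.Language.Structure.funMap f x) : Fin (n + 1) → K) := by
    intro K _ x y
    ext i
    refine Fin.lastCases ?_ (fun i => ?_) i <;> simp [tf]
  have hθ : ∀ {K : Type u} [L.Structure K] (x : Fin n → K) (y : K),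
      θ.Realize (Fin.snoc x y : Fin (n + 1) → K) ↔
      (φ.Realize (Fin.snoc x y : Fin (n + 1) → K) →
      φ.Realize (Fin.snoc x (FirstOrder.Language.Structure.funMap f x) : Fin (n + 1) → K)) := by
    intro K _ x y
    refine FirstOrder.Language.BoundedFormula.realize_imp.trans (imp_congr Iff.rfl ?_)
    rw [FirstOrder.Language.BoundedFormula.realize_subst, htf]
    rfl
  refine ⟨f, fun N _ hN x ⟨y, hy⟩ => ?_⟩
  refine (hθ x y).1 (realize_of_model_completeTheory (M := M) (fun z => ?_) hN _) hy
  rw [← Fin.snoc_init_self z]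
  exact (hθ _ _).2 fun h => hf _ ⟨_, h⟩

theorem HasSkolemSymbols.hasSkolemFunctions (h : HasSkolemSymbols L M) :
    HasSkolemFunctions (L.completeTheory M) := by
  intro n φ
  obtain ⟨f, hf⟩ := h.exists_symbol φ
  exact ⟨f, fun N x hx => hf N N.is_model x hx⟩

/-- Tarski–Vaught test: the Skolem symbol supplies a witness inside the substructure. -/
theorem HasSkolemSymbols.isElementary (h : HasSkolemSymbols L M) {N : Type u} [L.Structure N]
    (hN : N ⊨ L.completeTheory M) (S : L.Substructure N) : S.IsElementary := by
  refine S.isElementary_of_exists fun n φ x a hφ => ?_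
  let φ' : L.Formula (Fin (n + 1)) := φ.toFormula.relabel (Sum.elim Empty.elim id)
  have hφ' : ∀ z : Fin (n + 1) → N, φ'.Realize z ↔ φ.Realize default z := by
    intro z
    rw [FirstOrder.Language.Formula.realize_relabel,
      FirstOrder.Language.BoundedFormula.realize_toFormula]
    exact iff_of_eq (congrArg₂ _ (Subsingleton.elim _ _) rfl)
  obtain ⟨f, hf⟩ := h.exists_symbol φ'
  refine ⟨⟨FirstOrder.Language.Structure.funMap f fun i => (x i : N),
    S.fun_mem f _ fun i => (x i).2⟩, ?_⟩
  exact (hφ' _).1 (hf N hN _ ⟨a, (hφ' _).2 hφ⟩)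

end SkolemTransfer

/-! ### The tree-generated model inside an ultrapower. -/

section TreeModel

/-- The first `k` values of a branch. -/
def branchRestrict (k : ℕ) (η : ℕ → Bool) : Fin k → Bool := fun i => η i

/-- `E` chooses a branch through each node of level `k`. At every higher level these branches follow
one of the sections that `splitSet` quantifies over, so membership descends one level at a time. -/
theorem comp_section_mem {M : Type u} {S : ∀ l, Set ((Fin l → Bool) → M)}
    (hS : ∀ l, S (l + 1) ⊆ splitSet (S l)) {k : ℕ} (E : (Fin k → Bool) → ℕ → Bool)
    (hE : ∀ z, branchRestrict k (E z) = z) (d : ℕ) :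
    ∀ b ∈ S (k + d), (fun z => b (branchRestrict (k + d) (E z))) ∈ S k := by
  induction d with
  | zero =>
    intro b hb
    have : (fun z => b (branchRestrict (k + 0) (E z))) = b := funext fun z => congrArg b (hE z)
    rw [this]
    exact hb
  | succ d ih =>
    intro b hb
    have h1 := ih _ (hS (k + d) hb fun z => E (fun i => z (Fin.castAdd d i)) (k + d))
    have h2 : ∀ z : Fin k → Bool, branchRestrict (k + d + 1) (E z) =
        (Fin.snoc (branchRestrict (k + d) (E z))
          (E (fun i => branchRestrict (k + d) (E z) (Fin.castAdd d i)) (k + d)) :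
          Fin (k + d + 1) → Bool) := by
      intro z
      have hz : (fun i => branchRestrict (k + d) (E z) (Fin.castAdd d i)) = z := hE z
      rw [hz]
      ext i
      refine Fin.lastCases ?_ (fun i => ?_) i
      · simp [branchRestrict]
      · simp [branchRestrict]
    have h3 : (fun z => b (branchRestrict (k + d + 1) (E z))) = fun z : Fin k → Bool =>
        b (Fin.snoc (branchRestrict (k + d) (E z))
          (E (fun i => branchRestrict (k + d) (E z) (Fin.castAdd d i)) (k + d)) :
          Fin (k + d + 1) → Bool) := funext fun z => congrArg b (h2 z)
    exact h3 ▸ h1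

/-- Branches already told apart at level `k` extend to a choice of one branch through every node of
that level, to which `comp_section_mem` applies. -/
theorem exists_mem_comp_eq {M : Type u} {S : ∀ l, Set ((Fin l → Bool) → M)}
    (hS : ∀ l, S (l + 1) ⊆ splitSet (S l)) {k l : ℕ} (hkl : k ≤ l) {n : ℕ}
    (η : Fin n → ℕ → Bool)
    (hη : ∀ m m', branchRestrict k (η m) = branchRestrict k (η m') → η m = η m')
    {b : (Fin l → Bool) → M} (hb : b ∈ S l) :
    ∃ b' ∈ S k, ∀ m, b' (branchRestrict k (η m)) = b (branchRestrict l (η m)) := by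
  classical
  obtain ⟨d, rfl⟩ := Nat.exists_eq_add_of_le hkl
  have hex : ∀ z : Fin k → Bool, ∃ ν : ℕ → Bool, branchRestrict k ν = z ∧
      ∀ m, branchRestrict k (η m) = z → ν = η m := by
    intro z
    by_cases h : ∃ m, branchRestrict k (η m) = z
    · obtain ⟨m, hm⟩ := h
      exact ⟨η m, hm, fun m' hm' => hη _ _ (hm.trans hm'.symm)⟩
    · exact ⟨fun i => if hi : i < k then z ⟨i, hi⟩ else false, by
        ext i; simp [branchRestrict], fun m hm => absurd ⟨m, hm⟩ h⟩
  choose E hE hE' using hex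
  exact ⟨_, comp_section_mem hS E hE d b hb, fun m => by rw [hE' _ m rfl]⟩

theorem mk_closure_range_eq_continuum {L : FirstOrder.Language.{u, u}} (hL : L.card ≤ ℵ₀)
    {M : Type u} [L.Structure M] {a : (ℕ → Bool) → M} (ha : Function.Injective a) :
    Cardinal.mk (FirstOrder.Language.Substructure.closure L (Set.range a)) =
      Cardinal.continuum := by
  have hB : Cardinal.mk (ℕ → Bool) = Cardinal.continuum := by simp
  have hr : Cardinal.mk (Set.range a) = Cardinal.continuum.{u} := by
    have := Cardinal.mk_range_eq_of_injective ha
    rw [hB] at this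
    simpa using this
  refine le_antisymm ?_ ?_
  · have h1 := FirstOrder.Language.Substructure.lift_card_closure_le (L := L) (s := Set.range a)
    have h2 : Cardinal.mk (Σ i, L.Functions i) ≤ ℵ₀ := by
      refine le_trans ?_ hL
      rw [FirstOrder.Language.card_eq_card_functions_add_card_relations]
      simp [Cardinal.mk_sigma]
    simp only [Cardinal.lift_id, hr] at h1
    refine h1.trans (max_le Cardinal.aleph0_le_continuum ?_)
    exact (add_le_add le_rfl (h2.trans Cardinal.aleph0_le_continuum)).trans_eq
      (Cardinal.add_eq_self Cardinal.aleph0_le_continuum)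
  · rw [← hr]
    exact Cardinal.mk_le_mk_of_subset FirstOrder.Language.Substructure.subset_closure

theorem closure_range_codRestrict {L : FirstOrder.Language.{u, u}} {M : Type u} [L.Structure M]
    {I : Type*} (a : I → M) :
    FirstOrder.Language.Substructure.closure L (Set.range fun i =>
      (⟨a i, FirstOrder.Language.Substructure.subset_closure ⟨i, rfl⟩⟩ :
        FirstOrder.Language.Substructure.closure L (Set.range a))) = ⊤ := by
  set C := FirstOrder.Language.Substructure.closure L (Set.range a)
  set D := FirstOrder.Language.Substructure.closure L (Set.range fun i =>
    (⟨a i, FirstOrder.Language.Substructure.subset_closure ⟨i, rfl⟩⟩ : C))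
  have h : C ≤ D.map C.subtype.toHom := FirstOrder.Language.Substructure.closure_le.2 (by
    rintro _ ⟨i, rfl⟩
    exact ⟨⟨a i, _⟩, FirstOrder.Language.Substructure.subset_closure ⟨i, rfl⟩, rfl⟩)
  rw [eq_top_iff]
  intro x _
  obtain ⟨y, hy, hyx⟩ := h x.2
  have : y = x := Subtype.ext hyx
  exact this ▸ hy

open Filter in
/-- The tree model: an elementary substructure of an ultrapower generated by tree-indiscernibles,
which omits the types given by the complements of countably many countable covers. -/
theorem exists_tree_model {L : FirstOrder.Language.{u, u}} (hL : L.card ≤ ℵ₀) {M : Type u}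
    [L.Structure M] [Nonempty M] (hsk : HasSkolemSymbols L M) {A : Set M}
    (hA : Pr ω₁ (Cardinal.mk A)) {T : Type*} [Countable T] (m : T → ℕ)
    (χ : ∀ τ, ℕ → L.Formula (Fin (m τ)))
    (hχ : ∀ (τ : T) (x : Fin (m τ) → M), ∃ i, (χ τ i).Realize x) :
    ∃ (N : Type u) (_ : L.Structure N) (a : (ℕ → Bool) → N), N ⊨ L.completeTheory M ∧
      Cardinal.mk N = Cardinal.continuum ∧ TreeGenerated L a ∧
      (∀ φ : L.Formula (Fin 1), (∀ x : Fin 1 → M, x 0 ∈ A → φ.Realize x) →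
        ∀ η, φ.Realize fun _ => a η) ∧
      ∀ (τ : T) (η : Fin (m τ) → ℕ → Bool), ∃ i, (χ τ i).Realize (a ∘ η) := by
  have hcount : ∀ n, Countable (L.Formula (Fin n)) := fun n => countable_formula hL _
  obtain ⟨enc, henc⟩ := exists_injective_nat (T ⊕ Σ n, L.Formula (Fin n))
  let m' : T ⊕ (Σ n, L.Formula (Fin n)) → ℕ := Sum.elim m Sigma.fst
  -- A formula contributes the cover by itself and its negation, so that deciding the cover decides
  -- the formula.
  let χ' : ∀ τ, ℕ → L.Formula (Fin (m' τ)) := fun τ => match τ with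
    | .inl τ => χ τ
    | .inr φ => fun i => if i = 0 then φ.2 else φ.2.not
  obtain ⟨S, hSne, hS, hdec⟩ := exists_tree_approximation hL hA enc henc m' χ' (by
    rintro (τ | φ) x
    · exact hχ τ x
    · by_cases h : φ.2.Realize x
      · exact ⟨0, h⟩
      · exact ⟨1, h⟩)
  choose b hbS hbinj hbA using hSne
  let U : Type u := (hyperfilter ℕ : Filter ℕ).Product fun _ => M
  let a₀ : (ℕ → Bool) → U := fun η =>
    ((fun l => b l (branchRestrict l η) : ∀ _ : ℕ, M) : (hyperfilter ℕ : Filter ℕ).Product _)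
  have hlos : ∀ {n : ℕ} (φ : L.Formula (Fin n)) (η : Fin n → ℕ → Bool),
      φ.Realize (a₀ ∘ η) ↔ ∀ᶠ l in (hyperfilter ℕ : Filter ℕ),
        φ.Realize fun i => b l (branchRestrict l (η i)) := fun φ η =>
    FirstOrder.Language.Ultraproduct.realize_formula_cast (M := fun _ => M) φ
      fun i l => b l (branchRestrict l (η i))
  have hU : U ⊨ L.completeTheory M := by
    refine (Theory.model_iff _).2 fun σ hσ => ?_
    exact (FirstOrder.Language.Ultraproduct.sentence_realize (M := fun _ => M) σ).2
      (Eventually.of_forall fun _ => hσ)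
  have hlarge : ∀ k, ∀ᶠ l in (hyperfilter ℕ : Filter ℕ), k ≤ l := fun k =>
    Nat.hyperfilter_le_atTop (eventually_ge_atTop k)
  -- The index `i` depends on the nodes `s` alone, not on the branches through them. Both
  -- indiscernibility and the omission of types follow from this.
  have hdecide : ∀ τ k, enc τ ≤ k → ∀ s : Fin (m' τ) → Fin (k + 1) → Bool, ∃ i,
      ∀ η : Fin (m' τ) → ℕ → Bool, (∀ j, branchRestrict (k + 1) (η j) = s j) →
      (∀ j j', s j = s j' → η j = η j') → (χ' τ i).Realize (a₀ ∘ η) := by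
    intro τ k hk s
    obtain ⟨i, hi⟩ := hdec k τ hk s
    refine ⟨i, fun η hη hη' => (hlos _ _).2 ((hlarge (k + 1)).mono fun l hl => ?_)⟩
    obtain ⟨b', hb', hbb⟩ := exists_mem_comp_eq hS hl η
      (fun j j' h => hη' j j' (by rw [← hη, ← hη, h])) (hbS l)
    convert hi b' hb' using 1
    ext j
    rw [← hbb, hη]
    rfl
  have ha₀ : Function.Injective a₀ := by
    intro η ν h
    by_contra hne
    obtain ⟨i, hi⟩ := Function.ne_iff.1 hne
    have h1 : ∀ᶠ l in (hyperfilter ℕ : Filter ℕ),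
        b l (branchRestrict l η) = b l (branchRestrict l ν) := Quotient.exact h
    obtain ⟨l, hl, hl'⟩ := (h1.and (hlarge (i + 1))).exists
    exact hi (congrFun (hbinj l hl) ⟨i, hl'⟩)
  let C := FirstOrder.Language.Substructure.closure L (Set.range a₀)
  have hC : C.IsElementary := hsk.isElementary hU C
  let a : (ℕ → Bool) → C := fun η =>
    ⟨a₀ η, FirstOrder.Language.Substructure.subset_closure ⟨η, rfl⟩⟩
  have hCa : ∀ {n : ℕ} (φ : L.Formula (Fin n)) (η : Fin n → ℕ → Bool),
      φ.Realize (a ∘ η) ↔ φ.Realize (a₀ ∘ η) := fun φ η => (hC φ (a ∘ η)).symm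
  refine ⟨C, inferInstance, a, ?_, mk_closure_range_eq_continuum hL ha₀,
    ⟨closure_range_codRestrict a₀, fun η ν h => ha₀ (congrArg Subtype.val h), ?_⟩, ?_, ?_⟩
  · exact (ElementarySubstructure.theory_model_iff (⟨C, hC⟩ : L.ElementarySubstructure U) _).2 hU
  · intro n φ
    refine ⟨enc (.inr ⟨n, φ⟩), fun k hk η ν hην hη => ?_⟩
    obtain ⟨k, rfl⟩ : ∃ k', k = k' + 1 := ⟨k - 1, by omega⟩
    have hη' : ∀ j j', branchRestrict (k + 1) (η j) = branchRestrict (k + 1) (η j') → j = j' := by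
      intro j j' h
      by_contra hne
      rcases lt_or_gt_of_ne hne with hlt | hlt
      · obtain ⟨i, hi, hne⟩ := hη j j' hlt
        exact hne (congrFun h ⟨i, hi⟩)
      · obtain ⟨i, hi, hne⟩ := hη j' j hlt
        exact hne (congrFun h ⟨i, hi⟩).symm
    obtain ⟨i, hi⟩ := hdecide (.inr ⟨n, φ⟩) k (Nat.lt_succ_iff.1 hk)
      fun j => branchRestrict (k + 1) (η j)
    have h1 := hi η (fun _ => rfl) fun j j' h => congrArg η (hη' j j' h)
    have h2 := hi ν (fun j => funext fun p : Fin (k + 1) => (hην j p p.2).symm)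
      fun j j' h => congrArg ν (hη' j j' h)
    change φ.Realize (a ∘ η) ↔ φ.Realize (a ∘ ν)
    rw [hCa, hCa]
    by_cases hi0 : i = 0
    · simp only [χ', hi0] at h1 h2
      exact iff_of_true h1 h2
    · simp only [χ', hi0] at h1 h2
      exact iff_of_false h1 h2
  · intro φ hφ η
    change φ.Realize (a ∘ fun _ => η)
    rw [hCa, hlos]
    exact Eventually.of_forall fun l => hφ _ (hbA l _)
  · intro τ η
    obtain ⟨N, hN⟩ := exists_distinguishing_level η
    let k := max N (enc (.inl τ))
    obtain ⟨i, hi⟩ := hdecide (.inl τ) k (le_max_right _ _)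
      fun j => branchRestrict (k + 1) (η j)
    refine ⟨i, (hCa _ _).2 (hi η (fun _ => rfl) fun j j' h => ?_)⟩
    by_contra hne
    obtain ⟨p, hp, hne⟩ := hN (k + 1) ((le_max_left _ _).trans (Nat.le_succ _)) j j' hne
    exact hne (congrFun h ⟨p, hp⟩)

end TreeModel

/-! ### Subformulas of a formula of L_{ω₁,ω}. -/

section Subformulas

variable {L : FirstOrder.Language.{u, v}}

/-- The set of subformulas. -/
def InfFormula.subformulas : {n : ℕ} → InfFormula L n → Set (Σ n, InfFormula L n)
  | n, .falsum => {⟨n, .falsum⟩}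
  | n, .equal t₁ t₂ => {⟨n, .equal t₁ t₂⟩}
  | n, .rel R ts => {⟨n, .rel R ts⟩}
  | n, .imp φ ψ => {⟨n, .imp φ ψ⟩} ∪ (φ.subformulas ∪ ψ.subformulas)
  | n, .conj φ => {⟨n, .conj φ⟩} ∪ ⋃ i, (φ i).subformulas
  | n, .all φ => {⟨n, .all φ⟩} ∪ φ.subformulas

theorem InfFormula.countable_subformulas {n : ℕ} (θ : InfFormula L n) :
    θ.subformulas.Countable := by
  induction θ with
  | falsum => exact Set.countable_singleton _
  | equal => exact Set.countable_singleton _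
  | rel => exact Set.countable_singleton _
  | imp φ ψ h1 h2 => exact (Set.countable_singleton _).union (h1.union h2)
  | conj φ h => exact (Set.countable_singleton _).union (Set.countable_iUnion h)
  | all φ h => exact (Set.countable_singleton _).union h

theorem InfFormula.self_mem_subformulas {n : ℕ} (θ : InfFormula L n) :
    (⟨n, θ⟩ : Σ n, InfFormula L n) ∈ θ.subformulas := by
  cases θ <;> simp [InfFormula.subformulas]

theorem InfFormula.subformulas_subset {n : ℕ} (θ : InfFormula L n) {p : Σ n, InfFormula L n}
    (hp : p ∈ θ.subformulas) : p.2.subformulas ⊆ θ.subformulas := by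
  induction θ with
  | falsum => rw [Set.mem_singleton_iff.1 hp]
  | equal => rw [Set.mem_singleton_iff.1 hp]
  | rel => rw [Set.mem_singleton_iff.1 hp]
  | imp φ ψ h1 h2 =>
    rcases hp with hp | hp | hp
    · rw [Set.mem_singleton_iff.1 hp]
    · exact (h1 hp).trans fun q hq => Or.inr (Or.inl hq)
    · exact (h2 hp).trans fun q hq => Or.inr (Or.inr hq)
  | conj φ h =>
    rcases hp with hp | hp
    · rw [Set.mem_singleton_iff.1 hp]
    · obtain ⟨i, hi⟩ := Set.mem_iUnion.1 hp
      exact (h i hi).trans fun q hq => Or.inr (Set.mem_iUnion.2 ⟨i, hq⟩)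
  | all φ h =>
    rcases hp with hp | hp
    · rw [Set.mem_singleton_iff.1 hp]
    · exact (h hp).trans fun q hq => Or.inr hq

end Subformulas

/-! ### Transfer of L_{ω₁,ω}-truth to models omitting types. -/

section Transfer

variable {L L₁ : FirstOrder.Language.{u, u}} {M N : Type u} [L.Structure M] [L₁.Structure M]
  [L.Structure N] [L₁.Structure N]

theorem realize_iff_of_model_completeTheory {n : ℕ} {α β : L₁.Formula (Fin n)}
    (h : ∀ x : Fin n → M, α.Realize x ↔ β.Realize x)
    (hN : N ⊨ L₁.completeTheory M) (x : Fin n → N) : α.Realize x ↔ β.Realize x :=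
  FirstOrder.Language.Formula.realize_iff.1 (realize_of_model_completeTheory (θ := α.iff β)
    (fun x => FirstOrder.Language.Formula.realize_iff.2 (h x)) hN x)

/-- Formulas of `L_{ω₁,ω}` that are first order definable in `M` keep their definitions in every
model of the complete theory of `M` that omits the types of false conjunctions without false
conjuncts. -/
theorem InfFormula.realize_iff_of_omits (ι : L →ᴸ L₁) [ι.IsExpansionOn M] [ι.IsExpansionOn N]
    (hN : N ⊨ L₁.completeTheory M) (G : Set (Σ n, InfFormula L n))
    (F : ∀ n, InfFormula L n → L₁.Formula (Fin n))
    (hF : ∀ n θ, (⟨n, θ⟩ : Σ n, InfFormula L n) ∈ G → ∀ x : Fin n → M,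
      (F n θ).Realize x ↔ θ.Realize x)
    (hG : ∀ n φ, (⟨n, .conj φ⟩ : Σ n, InfFormula L n) ∈ G → ∀ x : Fin n → N,
      (F n (.conj φ)).Realize x ∨ ∃ i, ¬ (F n (φ i)).Realize x)
    {n : ℕ} (θ : InfFormula L n) (hθ : θ.subformulas ⊆ G) (x : Fin n → N) :
    θ.Realize x ↔ (F n θ).Realize x := by
  induction θ with
  | @falsum n =>
    have h := realize_iff_of_model_completeTheory (N := N) (β := (⊥ : L₁.Formula (Fin n)))
      (hF n _ (hθ (InfFormula.self_mem_subformulas _))) hN x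
    exact h.symm
  | @equal n t₁ t₂ =>
    have h := realize_iff_of_model_completeTheory (N := N) (α := F n (.equal t₁ t₂))
      (β := (ι.onTerm t₁).equal (ι.onTerm t₂)) (fun x => by
        rw [hF n _ (hθ (InfFormula.self_mem_subformulas _)),
          FirstOrder.Language.Formula.realize_equal, LHom.realize_onTerm, LHom.realize_onTerm]
        rfl) hN x
    rw [h, FirstOrder.Language.Formula.realize_equal, LHom.realize_onTerm, LHom.realize_onTerm]
    rfl
  | @rel n l R ts =>
    have hr : ∀ {K : Type u} [L.Structure K] [L₁.Structure K] [ι.IsExpansionOn K]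
        (x : Fin n → K), ((ι.onRelation R).formula fun i => ι.onTerm (ts i)).Realize x ↔
        (InfFormula.rel R ts).Realize x := by
      intro K _ _ _ x
      refine FirstOrder.Language.Formula.realize_rel.trans ?_
      rw [LHom.map_onRelation]
      simp only [LHom.realize_onTerm]
      rfl
    have h := realize_iff_of_model_completeTheory (N := N) (α := F n (.rel R ts))
      (β := (ι.onRelation R).formula fun i => ι.onTerm (ts i)) (fun x => by
        rw [hF n _ (hθ (InfFormula.self_mem_subformulas _)), hr]) hN x
    rw [h, hr]
  | @imp n φ ψ h1 h2 =>
    have hs1 : φ.subformulas ⊆ G := fun p hp => hθ (Or.inr (Or.inl hp))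
    have hs2 : ψ.subformulas ⊆ G := fun p hp => hθ (Or.inr (Or.inr hp))
    have h := realize_iff_of_model_completeTheory (N := N) (α := F n (.imp φ ψ))
      (β := (F n φ).imp (F n ψ)) (fun x => by
        rw [hF n _ (hθ (InfFormula.self_mem_subformulas _)),
          FirstOrder.Language.Formula.realize_imp, hF n _ (hs1 φ.self_mem_subformulas),
          hF n _ (hs2 ψ.self_mem_subformulas)]
        rfl) hN x
    rw [h, FirstOrder.Language.Formula.realize_imp, ← h1 hs1, ← h2 hs2]
    rfl
  | @conj n φ ih =>
    have hs : ∀ i, (φ i).subformulas ⊆ G := fun i p hp =>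
      hθ (Or.inr (Set.mem_iUnion.2 ⟨i, hp⟩))
    have hmem := hθ (InfFormula.self_mem_subformulas (.conj φ))
    have h : ∀ i, (F n (.conj φ)).Realize x → (F n (φ i)).Realize x := fun i =>
      FirstOrder.Language.Formula.realize_imp.1 (realize_of_model_completeTheory (N := N)
        (θ := (F n (.conj φ)).imp (F n (φ i))) (fun x => by
          rw [FirstOrder.Language.Formula.realize_imp, hF n _ hmem,
            hF n _ (hs i (φ i).self_mem_subformulas)]
          exact fun h => h i) hN x)
    constructor
    · intro hx
      -- Only here is the omission of types needed: the complete theory yields each conjunct from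
      -- the conjunction, but not the converse.
      refine (hG n φ hmem x).resolve_right ?_
      rintro ⟨i, hi⟩
      exact hi ((ih i (hs i) x).1 (hx i))
    · exact fun hx i => (ih i (hs i) x).2 (h i hx)
  | @all n φ ih =>
    have hs : φ.subformulas ⊆ G := fun p hp => hθ (Or.inr hp)
    let β : L₁.Formula (Fin n) := FirstOrder.Language.Formula.iAlls (Fin 1)
      ((F (n + 1) φ).relabel (Fin.snoc Sum.inl (Sum.inr 0) : Fin (n + 1) → Fin n ⊕ Fin 1))
    have hβ : ∀ {K : Type u} [L₁.Structure K] (x : Fin n → K), β.Realize x ↔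
        ∀ y : K, (F (n + 1) φ).Realize (Fin.snoc x y : Fin (n + 1) → K) := by
      intro K _ x
      refine FirstOrder.Language.Formula.realize_iAlls.trans ?_
      have hc : ∀ u : Fin 1 → K, (fun a => Sum.elim x u a) ∘
          (Fin.snoc Sum.inl (Sum.inr 0) : Fin (n + 1) → Fin n ⊕ Fin 1) =
          (Fin.snoc x (u 0) : Fin (n + 1) → K) := fun u => by
        rw [Fin.comp_snoc]; rfl
      simp only [FirstOrder.Language.Formula.realize_relabel, hc]
      exact ⟨fun h y => h fun _ => y, fun h u => h (u 0)⟩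
    have h := realize_iff_of_model_completeTheory (N := N) (α := F n (.all φ)) (β := β)
      (fun x => by
        rw [hF n _ (hθ (InfFormula.self_mem_subformulas _)), hβ]
        exact forall_congr' fun y => (hF _ _ (hs φ.self_mem_subformulas) _).symm) hN x
    rw [h, hβ]
    exact forall_congr' fun y => ih hs _

end Transfer

/-! ### Assembling the tree model of ψ. -/

section Main

theorem countable_term {L : FirstOrder.Language.{u, u}} (hL : L.card ≤ ℵ₀) (n : ℕ) :
    Countable (L.Term (Fin n)) := by
  rw [← Cardinal.mk_le_aleph0_iff]
  have h2 : Countable (Σ i, L.Functions i) := by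
    rw [← Cardinal.mk_le_aleph0_iff]
    refine le_trans ?_ hL
    rw [FirstOrder.Language.card_eq_card_functions_add_card_relations]
    simp [Cardinal.mk_sigma]
  refine Term.card_le.trans (max_le le_rfl ?_)
  rw [Cardinal.mk_le_aleph0_iff]
  infer_instance

theorem exists_terms_of_closure_eq_top {L : FirstOrder.Language.{u, u}} {N : Type u}
    [L.Structure N] {I : Type} {a : I → N}
    (ha : FirstOrder.Language.Substructure.closure L (Set.range a) = ⊤) {n : ℕ} (x : Fin n → N) :
    ∃ (m : ℕ) (η : Fin m → I) (t : Fin n → L.Term (Fin m)),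
      ∀ i, (t i).realize (a ∘ η) = x i := by
  classical
  have h : ∀ i, ∃ t : L.Term I, t.realize a = x i := by
    intro i
    have hx : x i ∈ FirstOrder.Language.Substructure.closure L (Set.range a) := by
      rw [ha]
      trivial
    obtain ⟨t, ht⟩ := FirstOrder.Language.Substructure.mem_closure_iff_exists_term.1 hx
    choose g hg using fun z : Set.range a => z.2
    refine ⟨t.relabel g, ?_⟩
    rw [Term.realize_relabel, ← ht]
    exact congrArg (fun v => t.realize v) (funext hg)
  choose t ht using h
  let s : Finset I := Finset.univ.biUnion fun i => (t i).varFinset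
  have hs : ∀ i, ∀ z : (t i).varFinset, (z : I) ∈ s := fun i z =>
    Finset.mem_biUnion.2 ⟨i, Finset.mem_univ _, z.2⟩
  refine ⟨s.card, fun j => (s.equivFin.symm j : I),
    fun i => (t i).restrictVar fun z => s.equivFin ⟨z, hs i z⟩, fun i => ?_⟩
  rw [← ht i]
  exact Term.realize_restrictVar a fun z => by simp

theorem Pr.nonempty {A : Type u} (h : Pr ω₁ (Cardinal.mk A)) : Nonempty A := by
  let _ : colourLanguage.{u}.Structure A := colourStructure fun _ _ _ => True
  obtain ⟨-, -, s, ⟨x, -⟩, -⟩ := exists_rkGE_of_omega_one_le _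
    (h colourLanguage colourLanguage_card A rfl) (Ordinal.omega_pos 1)
  exact ⟨x⟩

theorem exists_tree_model_of_pr {L : FirstOrder.Language.{u, u}} (hL : L.card ≤ ℵ₀)
    (ψ : InfSentence L) {M : Type u} [L.Structure M] (hψ : ψ.Models M) {A : Set M}
    (hA : Pr ω₁ (Cardinal.mk A)) :
    ∃ (L₁ : FirstOrder.Language.{u, u}) (ι : L →ᴸ L₁) (T₁ : L₁.Theory)
      (M₁ : Type u) (_ : L.Structure M₁) (_ : L₁.Structure M₁) (a : (ℕ → Bool) → M₁),
      L₁.card ≤ ℵ₀ ∧ ι.Injective ∧ ι.IsExpansionOn M₁ ∧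
      HasSkolemFunctions T₁ ∧ M₁ ⊨ T₁ ∧
      Cardinal.mk M₁ = Cardinal.continuum ∧
      ψ.Models M₁ ∧ TreeGenerated L₁ a ∧
      ∀ R : L.Relations 1, A ⊆ unaryPart R M → ∀ η, a η ∈ unaryPart R M₁ := by
  classical
  have hne : Nonempty M := hA.nonempty.map Subtype.val
  let G := InfFormula.subformulas ψ
  have hGc : G.Countable := InfFormula.countable_subformulas ψ
  obtain ⟨L₁, ι, _, hL₁, hι, _, hsk, hD⟩ := exists_skolem_expansion (M := M) hL
    (fun n => {S | ∃ θ : InfFormula L n, (⟨n, θ⟩ : Σ n, InfFormula L n) ∈ G ∧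
      S = {x : Fin n → M | θ.Realize x}}) (fun n => by
      have : Function.Injective fun θ : InfFormula L n => (⟨n, θ⟩ : Σ n, InfFormula L n) :=
        sigma_mk_injective
      refine ((hGc.preimage this).image fun θ => {x : Fin n → M | θ.Realize x}).mono ?_
      rintro S ⟨θ, hθ, rfl⟩
      exact ⟨θ, hθ, rfl⟩)
  have hF : ∀ n (θ : InfFormula L n), ∃ F : L₁.Formula (Fin n),
      (⟨n, θ⟩ : Σ n, InfFormula L n) ∈ G → ∀ x : Fin n → M, F.Realize x ↔ θ.Realize x := by
    intro n θ
    by_cases hθ : (⟨n, θ⟩ : Σ n, InfFormula L n) ∈ G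
    · obtain ⟨R, hR⟩ := hD n _ ⟨θ, hθ, rfl⟩
      exact ⟨R.formula fun i => Term.var i, fun _ x =>
        FirstOrder.Language.Formula.realize_rel.trans (hR x)⟩
    · exact ⟨⊥, fun h => absurd h hθ⟩
  choose F hF using hF
  -- Each subformula is paired with all tuples of terms. Every tuple of the hull is a tuple of terms
  -- in generators, so covers decided on generators control the whole hull.
  let T : Type u := Σ p : G, Σ m : ℕ, Fin p.1.1 → L₁.Term (Fin m)
  have hT : Countable T := by
    have := hGc.to_subtype
    have := countable_term hL₁
    infer_instance
  have hconj : ∀ τ : T, ∃ χ : ℕ → L₁.Formula (Fin τ.2.1),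
      (∀ x : Fin τ.2.1 → M, ∃ i, (χ i).Realize x) ∧
      ∀ φ, τ.1.1.2 = .conj φ → ∀ (K : Type u) [L₁.Structure K] (x : Fin τ.2.1 → K),
        (∃ i, (χ i).Realize x) →
        (F τ.1.1.1 (.conj φ)).Realize (fun j => (τ.2.2 j).realize x) ∨
        ∃ i, ¬ (F τ.1.1.1 (φ i)).Realize fun j => (τ.2.2 j).realize x := by
    rintro ⟨⟨⟨n, θ⟩, hθ⟩, m, t⟩
    by_cases h : ∃ φ, θ = .conj φ
    · obtain ⟨φ, rfl⟩ := h
      have hsub : ∀ {K : Type u} [L₁.Structure K] (β : L₁.Formula (Fin n)) (x : Fin m → K),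
          FirstOrder.Language.Formula.Realize (FirstOrder.Language.BoundedFormula.subst β t) x ↔
          β.Realize fun j => (t j).realize x := fun β x =>
        FirstOrder.Language.BoundedFormula.realize_subst
      -- Index `0` says that the conjunction holds at the terms, index `i + 1` that conjunct `i`
      -- fails there; in `M` one of these is always true.
      let χ : ℕ → L₁.Formula (Fin m) := fun k => k.casesOn
        (FirstOrder.Language.BoundedFormula.subst (F n (.conj φ)) t)
        fun i => FirstOrder.Language.Formula.not
          (FirstOrder.Language.BoundedFormula.subst (F n (φ i)) t)
      have hiG : ∀ i, (⟨n, φ i⟩ : Σ n, InfFormula L n) ∈ G := fun i =>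
        InfFormula.subformulas_subset ψ hθ
          (Or.inr (Set.mem_iUnion.2 ⟨i, (φ i).self_mem_subformulas⟩))
      refine ⟨χ, fun x => ?_, fun φ' hφ' K _ x => ?_⟩
      · by_cases hx : InfFormula.Realize (.conj φ) fun j => (t j).realize x
        · exact ⟨0, (hsub _ x).2 ((hF n _ hθ _).2 hx)⟩
        · obtain ⟨i, hi⟩ := not_forall.1 hx
          exact ⟨i + 1, fun hc => hi ((hF n _ (hiG i) _).1 ((hsub _ x).1 hc))⟩
      · obtain rfl : φ = φ' := by simpa using hφ'
        rintro ⟨k, hk⟩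
        cases k with
        | zero => exact Or.inl ((hsub _ x).1 hk)
        | succ i => exact Or.inr ⟨i, fun hc => hk ((hsub _ x).2 hc)⟩
    · exact ⟨fun _ => ⊤, fun x => ⟨0, FirstOrder.Language.Formula.realize_top.2 trivial⟩,
        fun φ hφ => absurd ⟨φ, hφ⟩ h⟩
  choose χ hχ hχ' using hconj
  obtain ⟨N, _, a, hN, hcard, hgen, hR, hom⟩ :=
    exists_tree_model hL₁ hsk hA (fun τ : T => τ.2.1) χ hχ
  let _ : L.Structure N := ι.reduct N
  have hexp : ι.IsExpansionOn N := ι.isExpansionOn_reduct N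
  refine ⟨L₁, ι, L₁.completeTheory M, N, inferInstance, inferInstance, a, hL₁, hι, hexp,
    HasSkolemSymbols.hasSkolemFunctions hsk, hN, hcard, ?_, hgen, ?_⟩
  · have hrec := InfFormula.realize_iff_of_omits (M := M) (N := N) ι hN G F hF ?_ ψ subset_rfl
      Fin.elim0
    · refine hrec.2 (realize_of_model_completeTheory (M := M) (fun x => ?_) hN _)
      rw [Subsingleton.elim x Fin.elim0]
      exact (hF 0 ψ (InfFormula.self_mem_subformulas ψ) _).2 hψ
    · intro n φ hφ x
      obtain ⟨m, η, t, ht⟩ := exists_terms_of_closure_eq_top hgen.hull x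
      let τ : T := ⟨⟨_, hφ⟩, m, t⟩
      have := hχ' τ φ rfl N (a ∘ η) (hom τ η)
      rw [← show (fun j => (t j).realize (a ∘ η)) = x from funext ht]
      exact this
  · intro R hAR η
    have := hR ((ι.onRelation R).formula fun i => Term.var i) (fun x hx => by
      refine FirstOrder.Language.Formula.realize_rel.2 ?_
      rw [LHom.map_onRelation]
      have hx0 : (fun i => Term.realize x (Term.var i : L₁.Term (Fin 1))) = ![x 0] := by
        ext i
        rw [Subsingleton.elim i 0]
        rfl
      rw [hx0]
      exact hAR hx) η
    have := FirstOrder.Language.Formula.realize_rel.1 this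
    rw [LHom.map_onRelation] at this
    have hx0 : (fun i => Term.realize (fun _ => a η) (Term.var i : L₁.Term (Fin 1))) =
        ![a η] := by
      ext i
      rw [Subsingleton.elim i 0]
      rfl
    rw [hx0] at this
    exact this

/-- Passing to a subset of R^M of size exactly `lam` avoids any appeal to monotonicity of Pr in the
cardinal. -/
theorem Pr.treeModelProperty {lam : Cardinal.{u}} (h : Pr ω₁ lam) : TreeModelProperty lam := by
  rintro L hL R ψ ⟨M, _, hψ, hR⟩
  obtain ⟨A, hAR, rfl⟩ := Cardinal.le_mk_iff_exists_subset.1 hR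
  obtain ⟨L₁, ι, T₁, M₁, _, _, a, h1, h2, h3, h4, h5, h6, h7, h8, h9⟩ :=
    exists_tree_model_of_pr hL ψ hψ h
  exact ⟨L₁, ι, T₁, M₁, _, _, a, h1, h2, h3, h4, h5, h6, h7, h8, h9 R hAR⟩

theorem Pr.continuumHanfBound {μ : Cardinal.{u}} (h : Pr ω₁ μ) : ContinuumHanfBound μ := by
  rintro L hL ψ ⟨M, _, hψ, hM⟩
  obtain ⟨A, rfl⟩ := Cardinal.le_mk_iff_exists_set.1 hM
  obtain ⟨L₁, ι, T₁, M₁, _, _, a, -, -, -, -, -, h6, h7, -⟩ :=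
    exists_tree_model_of_pr hL ψ hψ h
  exact ⟨M₁, _, h7, h6⟩

end Main

theorem claim2p1 :
    (∀ lam : Cardinal.{u}, Pr ω₁ lam ↔ TreeModelProperty lam) ∧
    (∀ (L₁ : FirstOrder.Language.{u, u}) (T₁ : L₁.Theory) (M₁ : Type u) [L₁.Structure M₁]
      (a : (ℕ → Bool) → M₁), HasSkolemFunctions T₁ → M₁ ⊨ T₁ → TreeGenerated L₁ a →
      ∀ η, a η ∉ FirstOrder.Language.Substructure.closure L₁ (a '' {ν | ν ≠ η})) ∧
    (∀ μ : Cardinal.{u}, IsLeast {lam : Cardinal.{u} | Pr ω₁ lam} μ →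
      ContinuumHanfBound μ ∧
      (μ < Cardinal.continuum → IsLeast {ν : Cardinal.{u} | ContinuumHanfBound ν} μ)) := by
  refine ⟨fun lam => ⟨Pr.treeModelProperty, TreeModelProperty.pr⟩,
    fun L₁ T₁ M₁ _ a _ _ ha η => ha.notMem_closure η, fun μ hμ => ?_⟩
  have h := Pr.continuumHanfBound hμ.1
  exact ⟨h, fun hc => ⟨h, fun ν hν => le_of_continuumHanfBound hμ hc hν⟩⟩
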